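/- All vector spaces are over $\mathbb C$; superalgebras and their modules are $\mathbb Z/2$-graded, a module is simple if it is nonzero and has no graded submodules other than $0$ and itself, and isomorphisms preserve parity. Let $\mathcal S$ be the Lie superalgebra with even basis elements $L_m$ ($m\in\mathbb Z$), $c$, $z$ and odd basis elements $\psi_n$ ($n\in\mathbb Z$), and with brackets $$[L_m,L_n]=(m-n)L_{m+n}+\delta_{m+n,0}\tfrac{m^3-m}{12}c,\quad [L_m,\psi_n]=\left(-n-\tfrac m2\right)\psi_{m+n},\quad [\psi_m,\psi_n]=\delta_{m+n,0}\,z,$$ $c,z$ central. Let $\mathrm{Vir}=\mathrm{span}\{L_m,c\}$ and $F=\mathrm{span}\{\psi_n,z\}$. A module over $\mathcal S$ or $\mathrm{Vir}$ is called a highest weight module if $L_0$ acts diagonalizably and, for some $\alpha\in\mathbb C$, all eigenvalues of $L_0$ lie in $\alpha+\mathbb Z_{\ge 0}$. Let $\mathscr V$ be the exterior algebra on odd generators $\xi_0,\xi_1,\xi_2,\dots$, with the following operators: for $n>0$, $\psi_n$ acts as $\partial/\partial\xi_n$ and $\psi_{-n}$ as left multiplication by $\xi_n$; $\psi_0$ acts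 as $\frac1{\sqrt2}(\xi_0+\partial/\partial\xi_0)$; $z$ acts as $1$ and $c$ as $\frac12$; and $L_k$ acts as $$\bar L_k=\tfrac1{16}\delta_{k,0}+\tfrac12\sum_{j\in\mathbb Z}j:\!\psi_{-j}\psi_{j+k}\!:,$$ where $:\!\psi_j\psi_k\!:$ is $\psi_j\psi_k$ if $j\le k$ and $-\psi_k\psi_j$ if $j>k$. For $\mu\in\mathbb C^*$ let $\mathscr V^{\mu}$ be the same space on which $L_k$ and $c$ act as on $\mathscr V$, and $\psi_n$, $z$ act as $\mu\psi_n$, $\mu^2z$ do on $\mathscr V$. For a $\mathrm{Vir}$-module $M$ let $M^{\mathcal S}$ be $M$, placed in even degree, with $F$ acting by $0$. **Theorem.** Let $V$ be a simple highest weight $\mathcal S$-module. 1. If $z$ acts on $V$ as a scalar $\lambda\in\mathbb C^*$, then for some $\sqrt\lambda\in\mathbb C$ with $(\sqrt\lambda)^2=\lambda$ the space $\mathscr V^{\sqrt\lambda}$ is an $\mathcal S$-module, and $V\cong\mathscr V^{\sqrt\lambda}\otimes M^{\mathcal S}$ as $\mathcal S$-modules for some simple highest weight $\mathrm{Vir}$-module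 $M$. 2. If $zV=0$, then $FV=0$ and $V$ is a simple highest weight $\mathrm{Vir}$-module. -/

import Mathlib

open scoped TensorProduct

universe u

noncomputable section

namespace FermionVirasoro

/-! ### Superspaces, Lie superalgebras and their modules (over `ℂ`) -/

/-- A `ℤ/2`-grading `V = V₀ ⊕ V₁` of a complex vector space. -/
structure SuperGrading (V : Type*) [AddCommGroup V] [Module ℂ V] where
  part : ZMod 2 → Submodule ℂ V
  isCompl : IsCompl (part 0) (part 1)

namespace SuperGrading

variable {V W : Type*} [AddCommGroup V] [Module ℂ V] [AddCommGroup W] [Module ℂ W]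

/-- The projection of `V` onto its even part along its odd part. -/
def evenProj (g : SuperGrading V) : V →ₗ[ℂ] V := (g.part 0).projection (g.part 1) g.isCompl

/-- The projection of `V` onto its odd part along its even part. -/
def oddProj (g : SuperGrading V) : V →ₗ[ℂ] V := (g.part 1).projection (g.part 0) g.isCompl.symm

/-- The parity operator, `v ↦ (-1)^|v| v` on homogeneous vectors. -/
def parityOp (g : SuperGrading V) : V →ₗ[ℂ] V := g.evenProj - g.oddProj

/-- A subspace is graded if it is the sum of its even and its odd part. -/
def IsGraded (g : SuperGrading V) (N : Submodule ℂ V) : Prop :=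
  N = (N ⊓ g.part 0) ⊔ (N ⊓ g.part 1)

/-- The grading of a vector space concentrated in even degree. -/
def pureEven (V : Type*) [AddCommGroup V] [Module ℂ V] : SuperGrading V where
  part i := if i = 0 then ⊤ else ⊥
  isCompl := by simpa using isCompl_top_bot

theorem parityOp_even (g : SuperGrading V) {v : V} (hv : v ∈ g.part 0) : g.parityOp v = v := by
  have h1 : g.evenProj v = v := (Submodule.projection_eq_self_iff g.isCompl v).2 hv
  have h2 : g.oddProj v = 0 := (Submodule.projection_apply_eq_zero_iff g.isCompl.symm).2 hv
  simp [parityOp, h1, h2]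

theorem parityOp_odd (g : SuperGrading V) {v : V} (hv : v ∈ g.part 1) : g.parityOp v = -v := by
  have h1 : g.evenProj v = 0 := (Submodule.projection_apply_eq_zero_iff g.isCompl).2 hv
  have h2 : g.oddProj v = v := (Submodule.projection_eq_self_iff g.isCompl.symm v).2 hv
  simp [parityOp, h1, h2]

/-- The grading of a tensor product: `(V ⊗ W)ₖ` is the sum of the `Vᵢ ⊗ Wⱼ` with `i + j = k`. -/
def tensor (g : SuperGrading V) (h : SuperGrading W) : SuperGrading (V ⊗[ℂ] W) where
  part k := ⨆ i : ZMod 2, Submodule.map₂ (TensorProduct.mk ℂ V W) (g.part i) (h.part (k - i))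
  isCompl := by
    have two : ∀ (f : ZMod 2 → Submodule ℂ (V ⊗[ℂ] W)), (⨆ i, f i) = f 0 ⊔ f 1 := by
      intro f
      apply le_antisymm
      · refine iSup_le fun i => ?_
        fin_cases i
        · exact le_sup_left
        · exact le_sup_right
      · exact sup_le (le_iSup f 0) (le_iSup f 1)
    have e1 : (0 - 1 : ZMod 2) = 1 := rfl
    have e2 : (1 - 0 : ZMod 2) = 1 := rfl
    have e3 : (0 - 0 : ZMod 2) = 0 := rfl
    have e4 : (1 - 1 : ZMod 2) = 0 := rfl
    simp only [two, e1, e2, e3, e4]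
    have key0 : ∀ x ∈ Submodule.map₂ (TensorProduct.mk ℂ V W) (g.part 0) (h.part 0) ⊔
        Submodule.map₂ (TensorProduct.mk ℂ V W) (g.part 1) (h.part 1),
        TensorProduct.map g.parityOp h.parityOp x = x := by
      intro x hx
      refine (?_ : _ ≤ LinearMap.eqLocus (TensorProduct.map g.parityOp h.parityOp) LinearMap.id) hx
      exact
        sup_le
          (Submodule.map₂_le.2 fun v hv w hw => by
            simp [LinearMap.mem_eqLocus, parityOp_even g hv, parityOp_even h hw])
          (Submodule.map₂_le.2 fun v hv w hw => by
            simp [LinearMap.mem_eqLocus, parityOp_odd g hv, parityOp_odd h hw,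
              TensorProduct.neg_tmul, TensorProduct.tmul_neg])
    have key1 : ∀ x ∈ Submodule.map₂ (TensorProduct.mk ℂ V W) (g.part 0) (h.part 1) ⊔
        Submodule.map₂ (TensorProduct.mk ℂ V W) (g.part 1) (h.part 0),
        TensorProduct.map g.parityOp h.parityOp x = -x := by
      intro x hx
      refine (?_ : _ ≤ LinearMap.eqLocus (TensorProduct.map g.parityOp h.parityOp) (-LinearMap.id)) hx
      exact
        sup_le
          (Submodule.map₂_le.2 fun v hv w hw => by
            simp [LinearMap.mem_eqLocus, parityOp_even g hv, parityOp_odd h hw,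
              TensorProduct.tmul_neg])
          (Submodule.map₂_le.2 fun v hv w hw => by
            simp [LinearMap.mem_eqLocus, parityOp_odd g hv, parityOp_even h hw,
              TensorProduct.neg_tmul])
    refine ⟨Submodule.disjoint_def.2 fun x hx hy => ?_, codisjoint_iff.2 ?_⟩
    · have hxx : x = -x := (key0 x hx).symm.trans (key1 x hy)
      have h2 : (2 : ℂ) • x = 0 := by
        rw [two_smul]; nth_rewrite 1 [hxx]; exact neg_add_cancel x
      exact (smul_eq_zero.1 h2).resolve_left two_ne_zero
    · rw [eq_top_iff, ← TensorProduct.map₂_mk_top_top_eq_top, ← g.isCompl.sup_eq_top,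
        ← h.isCompl.sup_eq_top, Submodule.map₂_sup_left, Submodule.map₂_sup_right,
        Submodule.map₂_sup_right]
      refine sup_le (sup_le ?_ ?_) (sup_le ?_ ?_)
      · exact le_sup_of_le_left le_sup_left
      · exact le_sup_of_le_right le_sup_left
      · exact le_sup_of_le_right le_sup_right
      · exact le_sup_of_le_left le_sup_right

end SuperGrading

/-- The Koszul sign `(-1)^(ij)`. -/
def koszul (i j : ZMod 2) : ℂ := if i = 1 ∧ j = 1 then -1 else 1

/-- Lie superalgebras over `ℂ`. -/
class LieSuperalgebra (𝔤 : Type*) [AddCommGroup 𝔤] [Module ℂ 𝔤] where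
  grading : SuperGrading 𝔤
  bracket : 𝔤 →ₗ[ℂ] 𝔤 →ₗ[ℂ] 𝔤
  bracket_mem : ∀ {i j : ZMod 2} {x y : 𝔤}, x ∈ grading.part i → y ∈ grading.part j →
    bracket x y ∈ grading.part (i + j)
  skew : ∀ {i j : ZMod 2} {x y : 𝔤}, x ∈ grading.part i → y ∈ grading.part j →
    bracket x y = -(koszul i j • bracket y x)
  jacobi : ∀ {i j k : ZMod 2} {x y w : 𝔤},
    x ∈ grading.part i → y ∈ grading.part j → w ∈ grading.part k →
    bracket x (bracket y w) = bracket (bracket x y) w + koszul i j • bracket y (bracket x w)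

/-- A superspace `V` with a linear map from `𝔤` to the endomorphisms of `V` (no compatibility with
the bracket or the gradings is asked for here; see `SuperAction.IsModule`). -/
structure SuperAction (𝔤 : Type*) [AddCommGroup 𝔤] [Module ℂ 𝔤]
    (V : Type*) [AddCommGroup V] [Module ℂ V] where
  grading : SuperGrading V
  act : 𝔤 →ₗ[ℂ] Module.End ℂ V

namespace SuperAction

variable {𝔤 : Type*} [AddCommGroup 𝔤] [Module ℂ 𝔤]
variable {V W : Type*} [AddCommGroup V] [Module ℂ V] [AddCommGroup W] [Module ℂ W]

/-- `V` is a module over the Lie superalgebra `𝔤`. -/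
structure IsModule [LieSuperalgebra 𝔤] (A : SuperAction 𝔤 V) : Prop where
  act_mem : ∀ {i j : ZMod 2} {x : 𝔤} {v : V}, x ∈ (LieSuperalgebra.grading (𝔤 := 𝔤)).part i →
    v ∈ A.grading.part j → A.act x v ∈ A.grading.part (i + j)
  act_bracket : ∀ {i j : ZMod 2} {x y : 𝔤}, x ∈ (LieSuperalgebra.grading (𝔤 := 𝔤)).part i →
    y ∈ (LieSuperalgebra.grading (𝔤 := 𝔤)).part j → ∀ v : V,
    A.act (LieSuperalgebra.bracket x y) v =
      A.act x (A.act y v) - koszul i j • A.act y (A.act x v)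

/-- Simplicity: `V ≠ 0` and the only graded submodules are `0` and `V`. -/
def IsSimple (A : SuperAction 𝔤 V) : Prop :=
  Nontrivial V ∧ ∀ N : Submodule ℂ V, A.grading.IsGraded N →
    (∀ x : 𝔤, ∀ v ∈ N, A.act x v ∈ N) → N = ⊥ ∨ N = ⊤

/-- Isomorphism of modules: a parity-preserving linear bijection commuting with the actions. -/
def IsIso (A : SuperAction 𝔤 V) (B : SuperAction 𝔤 W) : Prop :=
  ∃ e : V ≃ₗ[ℂ] W, (∀ i : ZMod 2, ∀ v ∈ A.grading.part i, e v ∈ B.grading.part i) ∧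
    ∀ (x : 𝔤) (v : V), e (A.act x v) = B.act x (e v)

/-- The action obtained by letting `x` act as `σ x`. -/
def twist (A : SuperAction 𝔤 V) (σ : 𝔤 →ₗ[ℂ] 𝔤) : SuperAction 𝔤 V where
  grading := A.grading
  act := A.act ∘ₗ σ

/-- The tensor product: `x (v ⊗ w) = x v ⊗ w + (-1)^(|x||v|) v ⊗ x w` for homogeneous `x`, `v`. -/
def tensor [LieSuperalgebra 𝔤] (A : SuperAction 𝔤 V) (B : SuperAction 𝔤 W) :
    SuperAction 𝔤 (V ⊗[ℂ] W) where
  grading := A.grading.tensor B.grading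
  act :=
    { toFun := fun x => TensorProduct.map (A.act x) LinearMap.id
        + TensorProduct.map LinearMap.id
            (B.act ((LieSuperalgebra.grading (𝔤 := 𝔤)).evenProj x))
        + TensorProduct.map A.grading.parityOp
            (B.act ((LieSuperalgebra.grading (𝔤 := 𝔤)).oddProj x))
      map_add' := fun x y => by
        simp only [map_add, TensorProduct.map_add_left, TensorProduct.map_add_right]; abel
      map_smul' := fun a x => by
        simp only [map_smul, TensorProduct.map_smul_left, TensorProduct.map_smul_right, smul_add,
          RingHom.id_apply] }

end SuperAction

/-! ### The Fermion-Virasoro algebra `S = S(0)` -/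

/-- Labels of the basis `Lₘ`, `ψₙ` (`m, n ∈ ℤ`), `c`, `z` of `S`. -/
inductive SIdx : Type
  | L (m : ℤ)
  | psi (n : ℤ)
  | c
  | z

/-- The parity of a basis element of `S`: the `ψₙ` are odd, `Lₘ`, `c`, `z` are even. -/
def SIdx.parity : SIdx → ZMod 2
  | .psi _ => 1
  | _ => 0

/-- The underlying vector space of the Fermion-Virasoro algebra. -/
abbrev S : Type := SIdx →₀ ℂ

/-- The basis elements of `S`. -/
def S.e (a : SIdx) : S := Finsupp.single a 1

/-- The brackets of basis elements of `S`. -/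
def S.basisBracket : SIdx → SIdx → S
  | .L m, .L n => ((m : ℂ) - n) • S.e (.L (m + n))
      + (if m + n = 0 then ((m : ℂ) ^ 3 - m) / 12 else 0) • S.e .c
  | .L m, .psi n => (-(n : ℂ) - m / 2) • S.e (.psi (m + n))
  | .psi n, .L m => -((-(n : ℂ) - m / 2) • S.e (.psi (m + n)))
  | .psi m, .psi n => (if m + n = 0 then (1 : ℂ) else 0) • S.e .z
  | _, _ => 0

/-- The bilinear extension of `S.basisBracket`. -/
def S.bracket : S →ₗ[ℂ] S →ₗ[ℂ] S :=
  Finsupp.linearCombination ℂ fun a => Finsupp.linearCombination ℂ (S.basisBracket a)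

theorem S.bracket_e (a b : SIdx) : S.bracket (S.e a) (S.e b) = S.basisBracket a b := by
  simp [S.bracket, S.e]

/-- The grading of `S`: `S₁` is spanned by the `ψₙ`, and `S₀` by the `Lₘ`, `c` and `z`. -/
def S.grading : SuperGrading S where
  part i := Finsupp.supported ℂ ℂ {a | a.parity = i}
  isCompl := by
    refine ⟨Finsupp.disjoint_supported_supported ?_, Finsupp.codisjoint_supported_supported ?_⟩
    · rw [Set.disjoint_left]
      intro a h0 h1
      change a.parity = 0 at h0
      change a.parity = 1 at h1
      rw [h0] at h1
      exact absurd h1 (by decide)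
    · rw [codisjoint_iff, eq_top_iff]
      intro a _
      cases a
      case psi n => exact Or.inr rfl
      all_goals exact Or.inl rfl

theorem S.e_mem (a : SIdx) : S.e a ∈ S.grading.part a.parity :=
  Finsupp.single_mem_supported ℂ 1 rfl

theorem S.part_eq_span (i : ZMod 2) :
    S.grading.part i = Submodule.span ℂ (S.e '' {a | a.parity = i}) :=
  Finsupp.supported_eq_span_single ℂ _

/-- Two linear maps that agree on the basis elements of parity `i` agree on `Sᵢ`. -/
theorem S.eq_on_part {N : Type*} [AddCommGroup N] [Module ℂ N] {i : ZMod 2} {f g : S →ₗ[ℂ] N}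
    (h : ∀ a : SIdx, a.parity = i → f (S.e a) = g (S.e a)) {x : S} (hx : x ∈ S.grading.part i) :
    f x = g x := by
  rw [S.part_eq_span] at hx
  refine LinearMap.eqOn_span (f := f) (g := g) ?_ hx
  rintro _ ⟨a, ha, rfl⟩
  exact h a ha

theorem S.basisBracket_mem (a b : SIdx) :
    S.basisBracket a b ∈ S.grading.part (a.parity + b.parity) := by
  have h := S.e_mem
  have add : ∀ {i : ZMod 2} (r t : ℂ) (a b : SIdx), a.parity = i → b.parity = i →
      r • S.e a + t • S.e b ∈ S.grading.part i := fun r t a b ha hb =>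
    Submodule.add_mem _ (Submodule.smul_mem _ _ (ha ▸ h a)) (Submodule.smul_mem _ _ (hb ▸ h b))
  have one : ∀ {i : ZMod 2} (r : ℂ) (a : SIdx), a.parity = i →
      r • S.e a ∈ S.grading.part i := fun r a ha => Submodule.smul_mem _ _ (ha ▸ h a)
  cases a <;> cases b
  case L.L m n => exact add _ _ _ _ rfl rfl
  case L.psi m n => exact one _ _ rfl
  case psi.L n m => exact Submodule.neg_mem _ (one _ _ rfl)
  case psi.psi m n => exact one _ _ rfl
  all_goals exact Submodule.zero_mem _

theorem S.basisBracket_skew (a b : SIdx) :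
    S.basisBracket a b = -(koszul a.parity b.parity • S.basisBracket b a) := by
  cases a <;> cases b <;> simp [S.basisBracket, SIdx.parity, koszul]
  case L.L m n =>
    rw [add_comm n m]
    split_ifs with h
    · have hn : n = -m := by omega
      subst hn
      push_cast
      module
    · module
  case psi.psi m n =>
    rw [add_comm n m]
    split_ifs <;> simp

theorem S.basisBracket_jacobi (a b d : SIdx) :
    S.bracket (S.e a) (S.basisBracket b d) =
      S.bracket (S.basisBracket a b) (S.e d)
        + koszul a.parity b.parity • S.bracket (S.e b) (S.basisBracket a d) := by
  cases a <;> cases b <;> cases d <;>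
    simp [S.basisBracket, S.bracket_e, SIdx.parity, koszul, -ite_smul, -smul_ite]
  case L.L.L m n k =>
    rw [show n + (m + k) = m + (n + k) by ring, show m + n + k = m + (n + k) by ring]
    by_cases h : m + (n + k) = 0
    · have hk : k = -m - n := by omega
      subst hk
      simp only [h, if_true]
      push_cast
      module
    · simp only [h, if_false]
      module
  case L.L.psi m n k =>
    rw [show n + (m + k) = m + (n + k) by ring, show m + n + k = m + (n + k) by ring]
    module
  case L.psi.L m n k =>
    rw [show k + (m + n) = m + (k + n) by ring, show m + k + n = m + (k + n) by ring]
    module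
  case psi.L.L n m k =>
    rw [show k + (m + n) = m + (k + n) by ring, show m + k + n = m + (k + n) by ring]
    module
  case L.psi.psi m n k =>
    rw [show n + (m + k) = m + n + k by ring]
    by_cases h : m + n + k = 0
    · have hk : k = -m - n := by omega
      subst hk
      simp only [h, if_true]
      push_cast
      module
    · simp only [h, if_false]
      module
  case psi.L.psi n m k =>
    rw [show n + (m + k) = m + n + k by ring]
    by_cases h : m + n + k = 0
    · have hk : k = -m - n := by omega
      subst hk
      simp only [h, if_true]
      push_cast
      module
    · simp only [h, if_false]
      module
  case psi.psi.L n k m =>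
    rw [show n + (m + k) = m + n + k by ring, show k + (m + n) = m + n + k by ring]
    by_cases h : m + n + k = 0
    · have hk : k = -m - n := by omega
      subst hk
      simp only [h, if_true]
      push_cast
      module
    · simp only [h, if_false]
      module

instance : LieSuperalgebra S where
  grading := S.grading
  bracket := S.bracket
  bracket_mem {i j x y} hx hy := by
    rw [S.part_eq_span] at hx hy
    induction hx using Submodule.span_induction with
    | mem _ h =>
      obtain ⟨a, rfl, rfl⟩ := h
      induction hy using Submodule.span_induction with
      | mem _ h =>
        obtain ⟨b, rfl, rfl⟩ := h
        rw [S.bracket_e]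
        exact S.basisBracket_mem a b
      | zero => simp
      | add _ _ _ _ h1 h2 => rw [map_add]; exact Submodule.add_mem _ h1 h2
      | smul r _ _ h => rw [map_smul]; exact Submodule.smul_mem _ r h
    | zero => simp
    | add _ _ _ _ h1 h2 => rw [map_add]; exact Submodule.add_mem _ h1 h2
    | smul r _ _ h => rw [map_smul]; exact Submodule.smul_mem _ r h
  skew {i j x y} hx hy := by
    refine S.eq_on_part (f := S.bracket.flip y) (g := -(koszul i j • S.bracket y)) ?_ hx
    rintro a rfl
    refine S.eq_on_part (f := S.bracket (S.e a))
      (g := -(koszul a.parity j • S.bracket.flip (S.e a))) ?_ hy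
    rintro b rfl
    simpa [S.bracket_e] using S.basisBracket_skew a b
  jacobi {i j k x y w} hx hy hw := by
    refine S.eq_on_part (f := S.bracket.flip (S.bracket y w))
      (g := S.bracket.flip w ∘ₗ S.bracket.flip y
        + koszul i j • (S.bracket y ∘ₗ S.bracket.flip w)) ?_ hx
    rintro a rfl
    refine S.eq_on_part (f := S.bracket (S.e a) ∘ₗ S.bracket.flip w)
      (g := S.bracket.flip w ∘ₗ S.bracket (S.e a)
        + koszul a.parity j • S.bracket.flip (S.bracket (S.e a) w)) ?_ hy
    rintro b rfl
    refine S.eq_on_part (f := S.bracket (S.e a) ∘ₗ S.bracket (S.e b))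
      (g := S.bracket (S.bracket (S.e a) (S.e b))
        + koszul a.parity b.parity • (S.bracket (S.e b) ∘ₗ S.bracket (S.e a))) ?_ hw
    rintro d rfl
    simpa [S.bracket_e] using S.basisBracket_jacobi a b d

/-- The Fermion algebra `F`, the subspace of `S` spanned by the `ψₙ` and `z`. -/
def fermion : Submodule ℂ S := Submodule.span ℂ (Set.range (fun n : ℤ => S.e (.psi n)) ∪ {S.e .z})

/-- The map `σ_μ` of `S` (an automorphism if `μ ≠ 0`): `Lₖ ↦ Lₖ`, `ψₙ ↦ μ ψₙ`, `c ↦ c`, `z ↦ μ² z`. -/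
def sigma (μ : ℂ) : S →ₗ[ℂ] S :=
  Finsupp.linearCombination ℂ fun
    | .L m => S.e (.L m)
    | .psi n => μ • S.e (.psi n)
    | .c => S.e .c
    | .z => μ ^ 2 • S.e .z

/-! ### The Virasoro algebra and its modules -/

/-- Labels of the basis `Lₘ` (`m ∈ ℤ`), `c` of the Virasoro algebra. -/
inductive VirIdx : Type
  | L (m : ℤ)
  | c

/-- The Virasoro algebra. -/
abbrev Vir : Type := VirIdx →₀ ℂ

/-- The basis elements of `Vir`. -/
def Vir.e (a : VirIdx) : Vir := Finsupp.single a 1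

/-- The brackets of basis elements of `Vir`. -/
def Vir.basisBracket : VirIdx → VirIdx → Vir
  | .L m, .L n => ((m : ℂ) - n) • Vir.e (.L (m + n))
      + (if m + n = 0 then ((m : ℂ) ^ 3 - m) / 12 else 0) • Vir.e .c
  | _, _ => 0

/-- The bilinear extension of `Vir.basisBracket`. -/
def Vir.bracket : Vir →ₗ[ℂ] Vir →ₗ[ℂ] Vir :=
  Finsupp.linearCombination ℂ fun a => Finsupp.linearCombination ℂ (Vir.basisBracket a)

theorem Vir.bracket_e (a b : VirIdx) :
    Vir.bracket (Vir.e a) (Vir.e b) = Vir.basisBracket a b := by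
  simp [Vir.bracket, Vir.e]

/-- The inclusion of the labels. -/
def VirIdx.toSIdx : VirIdx → SIdx
  | .L m => .L m
  | .c => .c

/-- The inclusion `Vir ⊆ S`. -/
def virIncl : Vir →ₗ[ℂ] S := Finsupp.lmapDomain ℂ ℂ VirIdx.toSIdx

theorem virIncl_e (a : VirIdx) : virIncl (Vir.e a) = S.e a.toSIdx := by
  simp [virIncl, Vir.e, S.e]

theorem virIncl_injective : Function.Injective virIncl := by
  refine Finsupp.mapDomain_injective ?_
  rintro (m | _) (n | _) h <;> simp_all [VirIdx.toSIdx]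

theorem virIncl_even (x : Vir) : virIncl x ∈ S.grading.part 0 := by
  induction x using Finsupp.induction_linear with
  | zero => simp
  | add x y hx hy => rw [map_add]; exact Submodule.add_mem _ hx hy
  | single a r =>
    have h : Finsupp.single a r = r • Vir.e a := by simp [Vir.e]
    rw [h, map_smul, virIncl_e]
    cases a <;> exact Submodule.smul_mem _ _ (S.e_mem _)

theorem virIncl_bracket (x y : Vir) :
    virIncl (Vir.bracket x y) = S.bracket (virIncl x) (virIncl y) := by
  have h : Vir.bracket.compr₂ virIncl = S.bracket.compl₁₂ virIncl virIncl := by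
    refine Finsupp.lhom_ext' fun a => LinearMap.ext_ring (Finsupp.lhom_ext' fun b =>
      LinearMap.ext_ring ?_)
    change virIncl (Vir.bracket (Vir.e a) (Vir.e b)) =
      S.bracket (virIncl (Vir.e a)) (virIncl (Vir.e b))
    rw [Vir.bracket_e, virIncl_e, virIncl_e, S.bracket_e]
    cases a <;> cases b <;>
      simp [Vir.basisBracket, S.basisBracket, virIncl_e, VirIdx.toSIdx, -ite_smul]
  exact LinearMap.congr_fun₂ h x y

instance : LieRing Vir where
  bracket x y := Vir.bracket x y
  add_lie x y w := by simp only [map_add, LinearMap.add_apply]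
  lie_add x y w := by simp only [map_add]
  lie_self x := by
    apply virIncl_injective
    rw [virIncl_bracket, map_zero]
    have h := LieSuperalgebra.skew (𝔤 := S) (virIncl_even x) (virIncl_even x)
    change S.bracket (virIncl x) (virIncl x) = -((1 : ℂ) • S.bracket (virIncl x) (virIncl x)) at h
    rw [one_smul] at h
    have h2 : (2 : ℂ) • S.bracket (virIncl x) (virIncl x) = 0 := by
      rw [two_smul]; nth_rewrite 1 [h]; exact neg_add_cancel _
    exact (smul_eq_zero.1 h2).resolve_left two_ne_zero
  leibniz_lie x y w := by
    apply virIncl_injective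
    simp only [map_add, virIncl_bracket]
    have h := LieSuperalgebra.jacobi (𝔤 := S) (virIncl_even x) (virIncl_even y) (virIncl_even w)
    change _ = _ + (1 : ℂ) • _ at h
    rw [one_smul] at h
    exact h

instance : LieAlgebra ℂ Vir where
  lie_smul r x y := (Vir.bracket x).map_smul r y

/-- The condition on the operator `T` by which `L₀` acts in a highest weight module: `T` is
diagonalizable (sums of eigenspaces are automatically direct), and for some `α ∈ ℂ` all its
eigenvalues lie in `α + ℤ₊`. -/
def IsHighestWeightOp {V : Type*} [AddCommGroup V] [Module ℂ V] (T : Module.End ℂ V) : Prop :=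
  (⨆ β : ℂ, T.eigenspace β) = ⊤ ∧
    ∃ α : ℂ, ∀ β : ℂ, T.eigenspace β ≠ ⊥ → ∃ n : ℕ, β = α + n

/-- The action of `Vir` on a `Vir`-module as a linear map `x ↦ (v ↦ ⁅x, v⁆)`. -/
def virAct (M : Type*) [AddCommGroup M] [Module ℂ M] [LieRingModule Vir M]
    [LieModule ℂ Vir M] : Vir →ₗ[ℂ] Module.End ℂ M :=
  LinearMap.mk₂ ℂ (fun x v => ⁅x, v⁆) add_lie smul_lie lie_add lie_smul

/-- Highest weight modules over `Vir`. -/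
def VirIsHighestWeight (M : Type*) [AddCommGroup M] [Module ℂ M] [LieRingModule Vir M]
    [LieModule ℂ Vir M] : Prop :=
  IsHighestWeightOp (virAct M (Vir.e (.L 0)))

/-- Highest weight modules over `S`. -/
def SuperAction.IsHighestWeight {V : Type*} [AddCommGroup V] [Module ℂ V]
    (A : SuperAction S V) : Prop :=
  IsHighestWeightOp (A.act (S.e (.L 0)))

/-- The projection `S → Vir` with kernel `F`. -/
def virProj : S →ₗ[ℂ] Vir :=
  Finsupp.linearCombination ℂ fun
    | .L m => Vir.e (.L m)
    | .psi _ => 0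
    | .c => Vir.e .c
    | .z => 0

/-- The `S`-module `M^S` obtained from a `Vir`-module `M` by letting `F` act by zero; it is
concentrated in even degree. -/
def inflate (M : Type*) [AddCommGroup M] [Module ℂ M] [LieRingModule Vir M]
    [LieModule ℂ Vir M] : SuperAction S M where
  grading := SuperGrading.pureEven M
  act := virAct M ∘ₗ virProj

/-! ### The Fock space -/

/-- The exterior algebra on odd generators `ξᵢ`, `i ∈ ℤ₊`. -/
abbrev Fock : Type := ExteriorAlgebra ℂ (ℕ →₀ ℂ)

/-- The generator `ξᵢ`. -/
def xi (i : ℕ) : Fock := ExteriorAlgebra.ι ℂ (Finsupp.single i 1)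

/-- The operator `v ↦ ξᵢ v`. -/
def xiMul (i : ℕ) : Module.End ℂ Fock := LinearMap.mulLeft ℂ (xi i)

/-- The odd derivation `∂/∂ξᵢ`, i.e. contraction with the `i`-th coordinate. -/
def dxi (i : ℕ) : Module.End ℂ Fock := CliffordAlgebra.contractLeft (Finsupp.lapply i)

theorem dxi_algebraMap (i : ℕ) (r : ℂ) : dxi i (algebraMap ℂ Fock r) = 0 :=
  CliffordAlgebra.contractLeft_algebraMap _ _ _

theorem dxi_ι_mul (i : ℕ) (m : ℕ →₀ ℂ) (v : Fock) :
    dxi i (ExteriorAlgebra.ι ℂ m * v) = m i • v - ExteriorAlgebra.ι ℂ m * dxi i v :=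
  CliffordAlgebra.contractLeft_ι_mul _ _ _

/-- The action of `ψₙ` on the Fock space. -/
def fockPsi (n : ℤ) : Module.End ℂ Fock :=
  if 0 < n then dxi n.toNat
  else if n < 0 then xiMul (-n).toNat
  else (1 / (Real.sqrt 2 : ℂ)) • (xiMul 0 + dxi 0)

/-- The normally ordered product `:ψⱼ ψₖ:`. -/
def normalOrd (j k : ℤ) : Module.End ℂ Fock :=
  if j ≤ k then fockPsi j * fockPsi k else -(fockPsi k * fockPsi j)

theorem exists_dxi_eq_zero (v : Fock) : ∃ N : ℕ, ∀ n, N ≤ n → dxi n v = 0 := by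
  induction v using CliffordAlgebra.left_induction with
  | algebraMap r => exact ⟨0, fun n _ => dxi_algebraMap n r⟩
  | add x y hx hy =>
    obtain ⟨N, hN⟩ := hx
    obtain ⟨K, hK⟩ := hy
    exact ⟨max N K, fun n hn => by
      rw [map_add, hN n (le_of_max_le_left hn), hK n (le_of_max_le_right hn), add_zero]⟩
  | ι_mul x m hx =>
    obtain ⟨N, hN⟩ := hx
    refine ⟨max N (m.support.sup id + 1), fun n hn => ?_⟩
    have hm : m n = 0 := by
      by_contra h
      have := Finset.le_sup (f := id) (Finsupp.mem_support_iff.2 h)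
      simp only [id] at this
      omega
    exact (dxi_ι_mul n m x).trans (by rw [hm, hN n (le_of_max_le_left hn)]; simp)

/-- On a given vector, only finitely many terms of the series defining `L̄ₖ` are nonzero. -/
theorem normalOrd_finite (k : ℤ) (v : Fock) :
    (Function.support fun j : ℤ => (j : ℂ) • normalOrd (-j) (j + k) v).Finite := by
  obtain ⟨N, hN⟩ := exists_dxi_eq_zero v
  have kill : ∀ n : ℤ, (N : ℤ) < n → fockPsi n v = 0 := by
    intro n hn
    rw [fockPsi, if_pos (by omega)]
    exact hN _ (by omega)
  refine (Set.finite_Icc (-(N : ℤ) - |k|) (N + |k|)).subset fun j hj => ?_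
  by_contra hmem
  apply hj
  have h1 := le_abs_self k
  have h2 := neg_abs_le k
  have hj' : j < -(N : ℤ) - |k| ∨ (N : ℤ) + |k| < j := by
    by_contra h
    push Not at h
    exact hmem ⟨h.1, h.2⟩
  have hz : normalOrd (-j) (j + k) v = 0 := by
    unfold normalOrd
    split_ifs with hle
    · rw [Module.End.mul_apply, kill (j + k) (by omega), map_zero]
    · rw [LinearMap.neg_apply, Module.End.mul_apply, kill (-j) (by omega), map_zero, neg_zero]
  simp only [hz, smul_zero]

/-- The vertex operator `L̄ₖ = δ_{k,0}/16 + (1/2) ∑_{j ∈ ℤ} j :ψ₋ⱼ ψ_{j+k}:`; the sum is finite on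
every vector. -/
def fockL (k : ℤ) : Module.End ℂ Fock where
  toFun v := (if k = 0 then (1 / 16 : ℂ) else 0) • v
    + (1 / 2 : ℂ) • ∑ᶠ j : ℤ, (j : ℂ) • normalOrd (-j) (j + k) v
  map_add' v w := by
    have h : ∀ j : ℤ, (j : ℂ) • normalOrd (-j) (j + k) (v + w) =
        (j : ℂ) • normalOrd (-j) (j + k) v + (j : ℂ) • normalOrd (-j) (j + k) w := fun j => by
      rw [map_add, smul_add]
    simp only [h]
    rw [finsum_add_distrib (normalOrd_finite k v) (normalOrd_finite k w)]
    module
  map_smul' r v := by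
    have h : ∀ j : ℤ, (j : ℂ) • normalOrd (-j) (j + k) (r • v) =
        r • ((j : ℂ) • normalOrd (-j) (j + k) v) := fun j => by
      rw [map_smul, smul_comm]
    simp only [h, RingHom.id_apply]
    rw [← smul_finsum]
    module

/-- The Fock space with its `S`-action: `ψₙ` by `fockPsi n`, `Lₖ` by `L̄ₖ`, `c` by `1/2` and `z` by
`1`; the grading is the parity of the number of factors `ξᵢ`. -/
def fockAction : SuperAction S Fock where
  grading :=
    { part := CliffordAlgebra.evenOdd (0 : QuadraticForm ℂ (ℕ →₀ ℂ))
      isCompl := CliffordAlgebra.evenOdd_isCompl _ }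
  act := Finsupp.linearCombination ℂ fun
    | .L k => fockL k
    | .psi n => fockPsi n
    | .c => (1 / 2 : ℂ) • LinearMap.id
    | .z => LinearMap.id

end FermionVirasoro

end

noncomputable section

namespace FermionVirasoro

/-! ### Gradings and parity operators -/

namespace SuperGrading

variable {V W : Type*} [AddCommGroup V] [Module ℂ V] [AddCommGroup W] [Module ℂ W]

/-! Suppose that z acts by λ = r² ≠ 0. The operators r⁻¹ψₙ then satisfy the canonical
anticommutation relations, and since L₀ is bounded below every vector is killed by ψₙ for large n.
Hence V is generated by the nonpositive modes from the vectors killed by all ψₙ with n > 0. On these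
vacuum vectors ψ₀ is odd and injective with 2ψ₀² = λ, so it exchanges the even and the odd ones. Let
Ω be the space `evenVacuum` of even ones. Letting polynomials in the creation operators act on Ω
gives a bijection from 𝒱 ⊗ Ω to V that intertwines all ψₙ (`tensorMap_injective`,
`tensorMap_surjective`; both rest on `le_of_vacuum_le`).

An element x of Vir has the same commutators with the ψₙ on V as on the Fock factor. The difference
of the two actions therefore commutes with all ψₙ, preserves Ω and has the form 1 ⊗ ρ(x)
(`virShift_psi`, `act_tensorMap`). Cross terms cancel in brackets, so ρ is a representation. A
ρ-stable subspace N of Ω yields the graded submodule 𝒱 ⊗ N, so ρ is simple, and ρ(L₀) is L₀ - 1/16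
on Ω.

This needs 𝒱 to be a module. The commutators of L̄ₘ with ψₙ are computed directly. The defect [L̄ₘ,
L̄ₙ] - (m - n)L̄ₘ₊ₙ is an even operator commuting with all ψₖ, hence a scalar
(`exists_eq_smul_of_commute`), and by weights it vanishes for m + n ≠ 0. The remaining scalars obey
a recursion from the Jacobi identity, and their values at m = 1, 2 are read off on the vacuum; this
gives (m³ - m)/24 without manipulating double normally ordered sums.

Suppose instead that z acts by 0. Then the ψₙ anticommute, and some homogeneous lowest weight vector
w is killed by ψ₀. By induction each ψ₋ₙ w is singular and lies above the lowest weight, so it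
vanishes in a simple module (`eq_zero_of_singular`). The common kernel of the ψₙ is thus a nonzero
graded submodule, that is, V. Finally V is purely even or purely odd, so every Vir-stable subspace
is automatically graded. -/

theorem evenProj_mem (g : SuperGrading V) (v : V) : g.evenProj v ∈ g.part 0 := by
  exact Submodule.projection_apply_mem g.isCompl v

theorem oddProj_mem (g : SuperGrading V) (v : V) : g.oddProj v ∈ g.part 1 :=
  Submodule.projection_apply_mem g.isCompl.symm v

theorem evenProj_add_oddProj (g : SuperGrading V) (v : V) : g.evenProj v + g.oddProj v = v :=
  Submodule.projection_add_projection_eq_self g.isCompl v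

theorem evenProj_of_even (g : SuperGrading V) {v : V} (hv : v ∈ g.part 0) : g.evenProj v = v :=
  (Submodule.projection_eq_self_iff g.isCompl v).2 hv

theorem oddProj_of_even (g : SuperGrading V) {v : V} (hv : v ∈ g.part 0) : g.oddProj v = 0 :=
  (Submodule.projection_apply_eq_zero_iff g.isCompl.symm).2 hv

theorem evenProj_of_odd (g : SuperGrading V) {v : V} (hv : v ∈ g.part 1) : g.evenProj v = 0 :=
  (Submodule.projection_apply_eq_zero_iff g.isCompl).2 hv

theorem oddProj_of_odd (g : SuperGrading V) {v : V} (hv : v ∈ g.part 1) : g.oddProj v = v :=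
  (Submodule.projection_eq_self_iff g.isCompl.symm v).2 hv

theorem add_parityOp (g : SuperGrading V) (v : V) :
    v + g.parityOp v = (2 : ℂ) • g.evenProj v := by
  have h := g.evenProj_add_oddProj v
  have h2 : g.parityOp v = g.evenProj v - g.oddProj v := rfl
  nth_rewrite 1 [← h]
  rw [h2]
  module

theorem sub_parityOp (g : SuperGrading V) (v : V) :
    v - g.parityOp v = (2 : ℂ) • g.oddProj v := by
  have h := g.evenProj_add_oddProj v
  have h2 : g.parityOp v = g.evenProj v - g.oddProj v := rfl
  nth_rewrite 1 [← h]
  rw [h2]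
  module

theorem parityOp_eq_self_iff (g : SuperGrading V) {v : V} : g.parityOp v = v ↔ v ∈ g.part 0 := by
  refine ⟨fun h => ?_, g.parityOp_even⟩
  have h1 := g.sub_parityOp v
  rw [h, sub_self, eq_comm, smul_eq_zero] at h1
  have h2 := g.evenProj_add_oddProj v
  rw [h1.resolve_left two_ne_zero, add_zero] at h2
  exact h2 ▸ g.evenProj_mem v

theorem parityOp_eq_neg_iff (g : SuperGrading V) {v : V} : g.parityOp v = -v ↔ v ∈ g.part 1 := by
  refine ⟨fun h => ?_, g.parityOp_odd⟩
  have h1 := g.add_parityOp v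
  rw [h, add_neg_cancel, eq_comm, smul_eq_zero] at h1
  have h2 := g.evenProj_add_oddProj v
  rw [h1.resolve_left two_ne_zero, zero_add] at h2
  exact h2 ▸ g.oddProj_mem v

theorem parityOp_map (g : SuperGrading V) (h : SuperGrading W) {T : V →ₗ[ℂ] W}
    (hT : ∀ i, ∀ v ∈ g.part i, T v ∈ h.part i) (v : V) :
    h.parityOp (T v) = T (g.parityOp v) := by
  nth_rewrite 1 [← g.evenProj_add_oddProj v]
  rw [map_add, map_add, h.parityOp_even (hT 0 _ (g.evenProj_mem v)),
    h.parityOp_odd (hT 1 _ (g.oddProj_mem v)), parityOp, LinearMap.sub_apply, map_sub]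
  abel

theorem parityOp_map_odd (g : SuperGrading V) (h : SuperGrading W) {T : V →ₗ[ℂ] W}
    (hT : ∀ i, ∀ v ∈ g.part i, T v ∈ h.part (1 + i)) (v : V) :
    h.parityOp (T v) = -T (g.parityOp v) := by
  nth_rewrite 1 [← g.evenProj_add_oddProj v]
  rw [map_add, map_add, h.parityOp_odd (hT 0 _ (g.evenProj_mem v)),
    h.parityOp_even (hT 1 _ (g.oddProj_mem v)), parityOp, LinearMap.sub_apply, map_sub]
  abel

/-- The even and odd parts are the ±1 eigenspaces of the parity operator. Parity of an operator thus
becomes a commutation identity, which can be checked on generators. -/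
theorem map_mem_of_parityOp (g : SuperGrading V) (h : SuperGrading W) {T : V →ₗ[ℂ] W}
    (hT : ∀ v, h.parityOp (T v) = T (g.parityOp v)) (i : ZMod 2) {v : V} (hv : v ∈ g.part i) :
    T v ∈ h.part i := by
  fin_cases i
  · refine h.parityOp_eq_self_iff.1 ?_
    rw [hT, g.parityOp_even hv]
  · refine h.parityOp_eq_neg_iff.1 ?_
    rw [hT, g.parityOp_odd hv, map_neg]

theorem map_mem_of_parityOp_neg (g : SuperGrading V) (h : SuperGrading W) {T : V →ₗ[ℂ] W}
    (hT : ∀ v, h.parityOp (T v) = -T (g.parityOp v)) (i : ZMod 2) {v : V} (hv : v ∈ g.part i) :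
    T v ∈ h.part (1 + i) := by
  fin_cases i
  · refine h.parityOp_eq_neg_iff.1 ?_
    rw [hT, g.parityOp_even hv]
  · refine h.parityOp_eq_self_iff.1 ?_
    rw [hT, g.parityOp_odd hv, map_neg, neg_neg]

/-- The components of v are half of v ± Pv, with P the parity operator, so gradedness of a subspace
follows from its stability under P. -/
theorem isGraded_of_parityOp_mem (g : SuperGrading V) {N : Submodule ℂ V}
    (h : ∀ v ∈ N, g.parityOp v ∈ N) : g.IsGraded N := by
  refine le_antisymm (fun v hv => ?_) (sup_le inf_le_left inf_le_left)
  have he : g.evenProj v ∈ N := by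
    have := N.smul_mem (2⁻¹ : ℂ) (N.add_mem hv (h v hv))
    rwa [g.add_parityOp, inv_smul_smul₀ two_ne_zero] at this
  have ho : g.oddProj v ∈ N := by
    have := N.smul_mem (2⁻¹ : ℂ) (N.sub_mem hv (h v hv))
    rwa [g.sub_parityOp, inv_smul_smul₀ two_ne_zero] at this
  rw [← g.evenProj_add_oddProj v]
  exact Submodule.add_mem_sup ⟨he, g.evenProj_mem v⟩ ⟨ho, g.oddProj_mem v⟩

theorem isGraded_span (g : SuperGrading V) {s : Set V} (hs : ∀ v ∈ s, ∃ i, v ∈ g.part i) :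
    g.IsGraded (Submodule.span ℂ s) := by
  refine g.isGraded_of_parityOp_mem fun v hv => ?_
  have : Submodule.span ℂ s ≤ (Submodule.span ℂ s).comap g.parityOp := by
    refine Submodule.span_le.2 fun w hw => ?_
    obtain ⟨i, hi⟩ := hs w hw
    change g.parityOp w ∈ Submodule.span ℂ s
    fin_cases i
    · rw [g.parityOp_even hi]
      exact Submodule.subset_span hw
    · rw [g.parityOp_odd hi]
      exact Submodule.neg_mem _ (Submodule.subset_span hw)
  exact this hv

theorem symm_mem_part (g : SuperGrading V) (h : SuperGrading W) (e : V ≃ₗ[ℂ] W)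
    (he : ∀ i, ∀ v ∈ g.part i, e v ∈ h.part i) (i : ZMod 2) {w : W} (hw : w ∈ h.part i) :
    e.symm w ∈ g.part i := by
  refine map_mem_of_parityOp h g (T := (e.symm : W →ₗ[ℂ] V)) (fun w => ?_) i hw
  simp only [LinearEquiv.coe_coe]
  apply e.injective
  have := parityOp_map g h (T := (e : V →ₗ[ℂ] W)) he (e.symm w)
  simp only [LinearEquiv.coe_coe, LinearEquiv.apply_symm_apply] at this ⊢
  exact this.symm

end SuperGrading

/-! ### Modules over `S` -/

theorem koszul_zero_left (i : ZMod 2) : koszul 0 i = 1 := by simp [koszul]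

theorem koszul_zero_right (i : ZMod 2) : koszul i 0 = 1 := by simp [koszul]

theorem koszul_one_one : koszul 1 1 = -1 := by simp [koszul]

section

variable {V : Type*} [AddCommGroup V] [Module ℂ V]

theorem S.mem_of_basis {N : Submodule ℂ V} {f : S →ₗ[ℂ] V} (h : ∀ a, f (S.e a) ∈ N) (x : S) :
    f x ∈ N := by
  induction x using Finsupp.induction_linear with
  | zero => simp
  | add x y hx hy => rw [map_add]; exact N.add_mem hx hy
  | single a r =>
    have : Finsupp.single a r = r • S.e a := by simp [S.e]
    rw [this, map_smul]
    exact N.smul_mem _ (h a)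

theorem SuperAction.isModule_of_basis (A : SuperAction S V)
    (h1 : ∀ a j, ∀ v ∈ A.grading.part j, A.act (S.e a) v ∈ A.grading.part (a.parity + j))
    (h2 : ∀ a b v, A.act (S.basisBracket a b) v = A.act (S.e a) (A.act (S.e b) v)
      - koszul a.parity b.parity • A.act (S.e b) (A.act (S.e a) v)) : A.IsModule where
  act_mem {i j x v} hx hv := by
    change x ∈ S.grading.part i at hx
    rw [S.part_eq_span] at hx
    induction hx using Submodule.span_induction with
    | mem _ h =>
      obtain ⟨a, rfl, rfl⟩ := h
      exact h1 a j v hv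
    | zero => simp
    | add _ _ _ _ h1 h2 => rw [map_add]; exact Submodule.add_mem _ h1 h2
    | smul r _ _ h => rw [map_smul]; exact Submodule.smul_mem _ r h
  act_bracket {i j x y} hx hy v := by
    refine S.eq_on_part (f := A.act.flip v ∘ₗ S.bracket.flip y)
      (g := A.act.flip (A.act y v) - koszul i j • (A.act y ∘ₗ A.act.flip v)) ?_ hx
    rintro a rfl
    refine S.eq_on_part (f := A.act.flip v ∘ₗ S.bracket (S.e a))
      (g := A.act (S.e a) ∘ₗ A.act.flip v
        - koszul a.parity j • (A.act.flip (A.act (S.e a) v))) ?_ hy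
    rintro b rfl
    simpa [S.bracket_e] using h2 a b v

theorem SuperAction.IsModule.basis_mem {A : SuperAction S V} (h : A.IsModule) (a : SIdx)
    {j : ZMod 2} {v : V} (hv : v ∈ A.grading.part j) :
    A.act (S.e a) v ∈ A.grading.part (a.parity + j) :=
  h.act_mem (S.e_mem a) hv

theorem SuperAction.IsModule.basis_bracket {A : SuperAction S V} (h : A.IsModule) (a b : SIdx)
    (v : V) : A.act (S.basisBracket a b) v = A.act (S.e a) (A.act (S.e b) v)
      - koszul a.parity b.parity • A.act (S.e b) (A.act (S.e a) v) := by
  rw [← S.bracket_e]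
  exact h.act_bracket (S.e_mem a) (S.e_mem b) v

theorem SuperAction.IsModule.psi_psi {A : SuperAction S V} (h : A.IsModule) (m n : ℤ) (v : V) :
    A.act (S.e (.psi m)) (A.act (S.e (.psi n)) v) + A.act (S.e (.psi n)) (A.act (S.e (.psi m)) v)
      = if m + n = 0 then A.act (S.e .z) v else 0 := by
  have := h.basis_bracket (.psi m) (.psi n) v
  simp only [SIdx.parity, koszul_one_one, neg_smul, one_smul, sub_neg_eq_add] at this
  rw [← this]
  simp only [S.basisBracket]
  split_ifs <;> simp

theorem SuperAction.IsModule.L_psi {A : SuperAction S V} (h : A.IsModule) (m n : ℤ) (v : V) :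
    A.act (S.e (.L m)) (A.act (S.e (.psi n)) v) = A.act (S.e (.psi n)) (A.act (S.e (.L m)) v)
      + (-(n : ℂ) - m / 2) • A.act (S.e (.psi (m + n))) v := by
  have := h.basis_bracket (.L m) (.psi n) v
  simp only [SIdx.parity, koszul_zero_left, one_smul, S.basisBracket, map_smul,
    LinearMap.smul_apply] at this
  rw [this]
  abel

theorem SuperAction.IsModule.parityOp_psi {A : SuperAction S V} (h : A.IsModule) (n : ℤ) (v : V) :
    A.grading.parityOp (A.act (S.e (.psi n)) v) = -A.act (S.e (.psi n)) (A.grading.parityOp v) :=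
  A.grading.parityOp_map_odd A.grading (fun _ _ hw => h.basis_mem (.psi n) hw) v

theorem virIncl_parity (x : Vir) : virIncl x ∈ (LieSuperalgebra.grading (𝔤 := S)).part 0 :=
  virIncl_even x

/-- The action of `Vir ⊆ S` on an `S`-module respects brackets. -/
theorem SuperAction.IsModule.act_virIncl_lie {A : SuperAction S V} (h : A.IsModule) (x y : Vir) :
    A.act (virIncl ⁅x, y⁆) = ⁅A.act (virIncl x), A.act (virIncl y)⁆ := by
  ext v
  have h1 : virIncl ⁅x, y⁆ = LieSuperalgebra.bracket (virIncl x) (virIncl y) :=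
    virIncl_bracket x y
  rw [h1, h.act_bracket (virIncl_parity x) (virIncl_parity y) v]
  simp [koszul_zero_left, Ring.lie_def]

/-- A linear map to endomorphisms that respects brackets makes the space a `Vir`-module. -/
theorem exists_lieModule_of_lie (ρ : Vir →ₗ[ℂ] Module.End ℂ V)
    (hρ : ∀ x y, ρ ⁅x, y⁆ = ⁅ρ x, ρ y⁆) :
    ∃ (_ : LieRingModule Vir V) (_ : LieModule ℂ Vir V), ∀ (x : Vir) (v : V), ⁅x, v⁆ = ρ x v := by
  let _ : LieRingModule Vir V :=
    { bracket := fun x v => ρ x v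
      add_lie := fun x y v => by simp only [map_add, LinearMap.add_apply]
      lie_add := fun x v w => map_add (ρ x) v w
      leibniz_lie := fun x y v => by
        change ρ x (ρ y v) = ρ ⁅x, y⁆ v + ρ y (ρ x v)
        rw [hρ, Ring.lie_def]
        simp }
  exact ⟨inferInstance,
    { smul_lie := fun t x v => by
        change ρ (t • x) v = t • ρ x v
        rw [map_smul, LinearMap.smul_apply]
      lie_smul := fun t x v => map_smul (ρ x) t v }, fun x v => rfl⟩

end

/-! ### Annihilation and creation operators -/

section

variable {X : Type*} [AddCommGroup X] [Module ℂ X]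

/-- If annihilation operators act locally nilpotently on an invariant subspace `K`, then every
subspace that contains the vacuum vectors of `K` and is stable under creation contains `K`. -/
theorem le_of_vacuum_le {a c : ℕ → Module.End ℂ X}
    (hac : ∀ m n x, a m (c n x) + c n (a m x) = if m = n then x else 0)
    (haa : ∀ m n x, a m (a n x) + a n (a m x) = 0) {K W : Submodule ℂ X}
    (hKa : ∀ n, ∀ x ∈ K, a n x ∈ K) (hKc : ∀ n, ∀ x ∈ K, c n x ∈ K)
    (hWc : ∀ n, ∀ x ∈ W, c n x ∈ W) (hvac : ∀ x ∈ K, (∀ n, a n x = 0) → x ∈ W)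
    (hnil : ∀ x ∈ K, ∃ N, ∀ n, N ≤ n → a n x = 0) : K ≤ W := by
  have key : ∀ N, ∀ x ∈ K, (∀ n, N ≤ n → a n x = 0) → x ∈ W := by
    intro N
    induction N with
    | zero => exact fun x hx h => hvac x hx fun n => h n (Nat.zero_le n)
    | succ N ih =>
      intro x hx h
      have hNN : ∀ y, a N (a N y) = 0 := fun y => by
        have := haa N N y
        rw [← two_smul ℂ, smul_eq_zero] at this
        exact this.resolve_left two_ne_zero
      -- Both a_N c_N x and a_N x are killed by all modes from N on, so the induction hypothesis
      -- applies to each; stability of W under c_N handles the second summand.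
      have e : a N (c N x) + c N (a N x) = x := by simpa using hac N N x
      rw [← e]
      refine W.add_mem (ih _ (hKa _ _ (hKc _ _ hx)) fun n hn => ?_)
        (hWc _ _ (ih _ (hKa _ _ hx) fun n hn => ?_))
      · rcases hn.eq_or_lt with rfl | hlt
        · exact hNN _
        · have h1 := hac n N x
          rw [h n hlt, map_zero, add_zero, if_neg (by omega)] at h1
          have h2 := haa n N (c N x)
          rwa [h1, map_zero, add_zero] at h2
      · rcases hn.eq_or_lt with rfl | hlt
        · exact hNN _
        · have h2 := haa n N x
          rwa [h n hlt, map_zero, add_zero] at h2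
  intro x hx
  obtain ⟨N, hN⟩ := hnil x hx
  exact key N x hx hN

/-- A vacuum vector in the image of the creation operators is zero. -/
theorem eq_zero_of_vacuum {a c : ℕ → Module.End ℂ X}
    (hac : ∀ m n x, a m (c n x) + c n (a m x) = if m = n then x else 0)
    (hcc : ∀ m n x, c m (c n x) + c n (c m x) = 0) {x : X} (hx : x ∈ ⨆ n, (c n).range)
    (hvac : ∀ n, a n x = 0) : x = 0 := by
  obtain ⟨f, hf, rfl⟩ := (Submodule.mem_iSup_iff_exists_finsupp _ _).1 hx
  choose y hy using hf
  have key : ∀ (s : Finset ℕ) (y : ℕ → X), (∀ n, a n (∑ i ∈ s, c i (y i)) = 0) →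
      ∑ i ∈ s, c i (y i) = 0 := by
    intro s
    induction s using Finset.induction_on with
    | empty => simp
    | insert k s hk ih =>
      intro y h
      -- As a_k kills the sum x, x = a_k c_k x. The term c_k y_k disappears because c_k² = 0. In the
      -- others a_k c_k moves past c_i with two sign changes, so x is again a sum of the same shape,
      -- without the index k.
      have h0 := hac k k (∑ i ∈ insert k s, c i (y i))
      rw [h k, map_zero, add_zero, if_pos rfl] at h0
      have h1 : ∑ i ∈ insert k s, c i (y i) = ∑ i ∈ s, c i (a k (c k (y i))) := by
        rw [← h0, map_sum, map_sum, Finset.sum_insert hk]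
        have hkk : c k (c k (y k)) = 0 := by
          have := hcc k k (y k)
          rw [← two_smul ℂ, smul_eq_zero] at this
          exact this.resolve_left two_ne_zero
        rw [hkk, map_zero, zero_add]
        refine Finset.sum_congr rfl fun i hi => ?_
        have hik : k ≠ i := fun e => hk (e ▸ hi)
        rw [eq_neg_of_add_eq_zero_left (hcc k i (y i)), map_neg]
        have := hac k i (c k (y i))
        rw [if_neg hik] at this
        rw [eq_neg_of_add_eq_zero_left this, neg_neg]
      rw [h1]
      refine ih _ fun n => ?_
      rw [← h1, h n]
  have e : f.sum (fun _ x => x) = ∑ i ∈ f.support, c i (y i) :=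
    Finset.sum_congr rfl fun i _ => (hy i).symm
  rw [e] at hvac ⊢
  exact key _ _ hvac

end

/-! ### Diagonalizable operators -/

section

variable {V : Type*} [AddCommGroup V] [Module ℂ V]

/-- Applying T - k removes the k-eigenvector from the sum and multiplies the others by μ - k ≠ 0,
which allows induction on the number of eigenvalues. -/
theorem mem_of_sum_eigenvectors_mem {T : Module.End ℂ V} {p : Submodule ℂ V}
    (hp : ∀ v ∈ p, T v ∈ p) (s : Finset ℂ) : ∀ f : ℂ → V, (∀ μ, T (f μ) = μ • f μ) →
      ∑ μ ∈ s, f μ ∈ p → ∀ μ ∈ s, f μ ∈ p := by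
  induction s using Finset.induction_on with
  | empty => simp
  | insert k s hk ih =>
    intro f hf h
    have hs : ∀ μ ∈ s, f μ ∈ p := by
      intro μ hμ
      have h1 := ih (fun μ => (μ - k) • f μ)
        (fun μ => by rw [map_smul, hf, smul_comm]) (by
          have h2 := p.sub_mem (hp _ h) (p.smul_mem k h)
          rw [map_sum, Finset.smul_sum, ← Finset.sum_sub_distrib, Finset.sum_insert hk, hf,
            sub_self, zero_add] at h2
          simpa only [sub_smul, hf] using h2) μ hμ
      have hne : μ - k ≠ 0 := sub_ne_zero.2 fun e => hk (e ▸ hμ)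
      have := p.smul_mem (μ - k)⁻¹ h1
      rwa [inv_smul_smul₀ hne] at this
    intro μ hμ
    rcases Finset.mem_insert.1 hμ with rfl | hμ
    · rw [Finset.sum_insert hk] at h
      exact (p.add_mem_iff_left (p.sum_mem hs)).1 h
    · exact hs μ hμ

theorem exists_sum_eigenvectors {T : Module.End ℂ V} (hT : (⨆ β : ℂ, T.eigenspace β) = ⊤) (v : V) :
    ∃ (s : Finset ℂ) (f : ℂ → V), (∀ μ, T (f μ) = μ • f μ) ∧ v = ∑ μ ∈ s, f μ := by
  have hv : v ∈ ⨆ β : ℂ, T.eigenspace β := hT ▸ Submodule.mem_top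
  obtain ⟨f, hf, rfl⟩ := (Submodule.mem_iSup_iff_exists_finsupp _ _).1 hv
  exact ⟨f.support, f, fun μ => Module.End.mem_eigenspace_iff.1 (hf μ), rfl⟩

/-- An operator on an invariant subspace that differs from a highest weight operator by a scalar
is again a highest weight operator. -/
theorem IsHighestWeightOp.of_restrict {T : Module.End ℂ V} (hT : IsHighestWeightOp T)
    {p : Submodule ℂ V} {T' : Module.End ℂ p} {s : ℂ} (h : ∀ v : p, (T' v : V) = T v - s • (v : V)) :
    IsHighestWeightOp T' := by
  obtain ⟨htop, α, hα⟩ := hT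
  have hp : ∀ v ∈ p, T v ∈ p := fun v hv => by
    have h1 : T v = T' ⟨v, hv⟩ + s • v := by rw [h]; abel
    rw [h1]
    exact p.add_mem (T' _).2 (p.smul_mem _ hv)
  have heig : ∀ (v : p) (β : ℂ), T (v : V) = β • (v : V) ↔ T' v = (β - s) • v := fun v β => by
    rw [← Subtype.coe_inj, h, Submodule.coe_smul, sub_smul, sub_left_inj]
  refine ⟨eq_top_iff.2 fun v _ => ?_, α - s, fun β hβ => ?_⟩
  · obtain ⟨S, f, hf, hv⟩ := exists_sum_eigenvectors htop (v : V)
    have hmem := mem_of_sum_eigenvectors_mem hp S f hf (hv ▸ v.2)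
    have : v = ∑ μ : S, (⟨f μ, hmem μ μ.2⟩ : p) := by
      apply Subtype.ext
      rw [hv, Submodule.coe_sum]
      exact (Finset.sum_coe_sort S f).symm
    rw [this]
    refine Submodule.sum_mem _ fun μ _ => Submodule.mem_iSup_of_mem ((μ : ℂ) - s) ?_
    exact Module.End.mem_eigenspace_iff.2 ((heig _ _).1 (hf μ))
  · obtain ⟨v, hv, hv0⟩ := Submodule.exists_mem_ne_zero_of_ne_bot hβ
    rw [Module.End.mem_eigenspace_iff] at hv
    obtain ⟨n, hn⟩ := hα (β + s) fun hbot => hv0 <| by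
      have : (v : V) ∈ T.eigenspace (β + s) :=
        Module.End.mem_eigenspace_iff.2 ((heig v _).2 (by rw [add_sub_cancel_right, hv]))
      rw [hbot, Submodule.mem_bot] at this
      exact Subtype.ext this
    exact ⟨n, by linear_combination hn⟩

end

/-! ### The fermions on the Fock space -/

theorem xiMul_apply (n : ℕ) (v : Fock) : xiMul n v = xi n * v := rfl

theorem xiMul_xiMul (m n : ℕ) (v : Fock) : xiMul m (xiMul n v) + xiMul n (xiMul m v) = 0 := by
  simp only [xiMul_apply, xi, ← mul_assoc, ← add_mul]
  rw [ExteriorAlgebra.ι_add_mul_swap, zero_mul]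

theorem dxi_dxi (m n : ℕ) (v : Fock) : dxi m (dxi n v) + dxi n (dxi m v) = 0 := by
  rw [← eq_neg_iff_add_eq_zero]
  exact CliffordAlgebra.contractLeft_comm _ _ v

theorem dxi_xiMul (m n : ℕ) (v : Fock) :
    dxi m (xiMul n v) + xiMul n (dxi m v) = if m = n then v else 0 := by
  rw [xiMul_apply, xi, dxi_ι_mul, xiMul_apply, xi, sub_add_cancel]
  split_ifs with h
  · rw [h, Finsupp.single_eq_same, one_smul]
  · rw [Finsupp.single_eq_of_ne h, zero_smul]

theorem dxi_one (n : ℕ) : dxi n 1 = 0 := by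
  rw [← map_one (algebraMap ℂ Fock)]
  exact dxi_algebraMap n 1

theorem fockPsi_pos (n : ℕ) : fockPsi (n + 1 : ℕ) = dxi (n + 1) := by
  rw [fockPsi, if_pos (by omega), Int.toNat_natCast]

theorem fockPsi_neg (n : ℕ) : fockPsi (-(n + 1 : ℕ)) = xiMul (n + 1) := by
  rw [fockPsi, if_neg (by omega), if_pos (by omega), neg_neg, Int.toNat_natCast]

theorem fockPsi_zero : fockPsi 0 = (1 / (Real.sqrt 2 : ℂ)) • (xiMul 0 + dxi 0) := by
  simp [fockPsi]

theorem sqrt_two_mul_self : (Real.sqrt 2 : ℂ) * (Real.sqrt 2 : ℂ) = 2 := by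
  rw [← Complex.ofReal_mul, Real.mul_self_sqrt (by norm_num)]
  norm_num

theorem sqrt_two_ne_zero : (Real.sqrt 2 : ℂ) ≠ 0 := fun h => by
  have := sqrt_two_mul_self
  rw [h, zero_mul] at this
  exact two_ne_zero this.symm

theorem int_cases (n : ℤ) : n = 0 ∨ (∃ k : ℕ, n = (k + 1 : ℕ)) ∨ ∃ k : ℕ, n = -(k + 1 : ℕ) := by
  rcases lt_trichotomy n 0 with h | h | h
  · exact Or.inr (Or.inr ⟨(-n).toNat - 1, by omega⟩)
  · exact Or.inl h
  · exact Or.inr (Or.inl ⟨n.toNat - 1, by omega⟩)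

/-- The factor 1/√2 is what makes the zero mode fit: (ξ₀ + ∂/∂ξ₀)² = 1 gives 2ψ₀² = 1. -/
theorem fockPsi_fockPsi (m n : ℤ) (v : Fock) :
    fockPsi m (fockPsi n v) + fockPsi n (fockPsi m v) = if m + n = 0 then v else 0 := by
  have dx : ∀ m n v, dxi m (xiMul n v) = (if m = n then v else 0) - xiMul n (dxi m v) :=
    fun m n v => eq_sub_of_add_eq (dxi_xiMul m n v)
  have zero_pos : ∀ k : ℕ, fockPsi 0 (fockPsi (k + 1 : ℕ) v) + fockPsi (k + 1 : ℕ) (fockPsi 0 v)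
      = 0 := fun k => by
    rw [fockPsi_pos, fockPsi_zero]
    simp only [LinearMap.smul_apply, LinearMap.add_apply, map_smul, map_add]
    rw [← smul_add, dx, if_neg (by omega), eq_neg_of_add_eq_zero_left (dxi_dxi (k + 1) 0 v)]
    module
  have zero_neg : ∀ k : ℕ, fockPsi 0 (fockPsi (-(k + 1 : ℕ)) v)
      + fockPsi (-(k + 1 : ℕ)) (fockPsi 0 v) = 0 := fun k => by
    rw [fockPsi_neg, fockPsi_zero]
    simp only [LinearMap.smul_apply, LinearMap.add_apply, map_smul, map_add]
    rw [← smul_add, dx, if_neg (by omega), eq_neg_of_add_eq_zero_left (xiMul_xiMul (k + 1) 0 v)]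
    module
  rcases int_cases m with rfl | ⟨a, rfl⟩ | ⟨a, rfl⟩ <;>
    rcases int_cases n with rfl | ⟨b, rfl⟩ | ⟨b, rfl⟩
  · have h1 := xiMul_xiMul 0 0 v
    have h2 := dxi_dxi 0 0 v
    rw [← two_smul ℂ, smul_eq_zero] at h1 h2
    rw [fockPsi_zero, add_zero, if_pos rfl]
    simp only [LinearMap.smul_apply, LinearMap.add_apply, map_smul, map_add]
    rw [dx, if_pos rfl, h1.resolve_left two_ne_zero, h2.resolve_left two_ne_zero, zero_add,
      add_zero, ← smul_add (1 / (Real.sqrt 2 : ℂ)) (v - _), sub_add_cancel, ← two_smul ℂ, smul_smul,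
      smul_smul, mul_assoc, div_mul_div_comm, sqrt_two_mul_self]
    norm_num
  · rw [zero_pos, if_neg (by omega)]
  · rw [zero_neg, if_neg (by omega)]
  · rw [add_comm, zero_pos, if_neg (by omega)]
  · rw [fockPsi_pos, fockPsi_pos, dxi_dxi, if_neg (by omega)]
  · rw [fockPsi_pos, fockPsi_neg, dxi_xiMul]
    exact if_congr (by omega) rfl rfl
  · rw [add_comm, zero_neg, if_neg (by omega)]
  · rw [fockPsi_pos, fockPsi_neg, add_comm, dxi_xiMul]
    exact if_congr (by omega) rfl rfl
  · rw [fockPsi_neg, fockPsi_neg, xiMul_xiMul, if_neg (by omega)]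

/-! ### Vacuum vectors of the Fock space -/

/-- By anticommutation, the sum of the images of ξ₁, ξ₂, … is stable under every left multiplication
by a generator. Modulo it only 1 and ξ₀ survive, since ξ₀² = 0. -/
theorem exists_vacuum_add (x : Fock) : ∃ (r t : ℂ) (y : Fock),
    y ∈ ⨆ n, (xiMul (n + 1)).range ∧ x = r • 1 + t • xi 0 + y := by
  have hxi : ∀ n, ∀ y ∈ ⨆ n, (xiMul (n + 1)).range, xiMul n y ∈ ⨆ n, (xiMul (n + 1)).range := by
    intro n y hy
    have : ⨆ n, (xiMul (n + 1)).range ≤ (⨆ n, (xiMul (n + 1)).range).comap (xiMul n) := by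
      refine iSup_le fun k => ?_
      rintro _ ⟨w, rfl⟩
      rw [Submodule.mem_comap, eq_neg_of_add_eq_zero_left (xiMul_xiMul n (k + 1) w)]
      exact Submodule.neg_mem _ (Submodule.mem_iSup_of_mem k ⟨_, rfl⟩)
    exact this hy
  induction x using CliffordAlgebra.left_induction with
  | algebraMap r => exact ⟨r, 0, 0, Submodule.zero_mem _, by
      rw [zero_smul, add_zero, add_zero]; exact Algebra.algebraMap_eq_smul_one r⟩
  | add x x' hx hx' =>
    obtain ⟨r, t, y, hy, rfl⟩ := hx
    obtain ⟨r', t', y', hy', rfl⟩ := hx'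
    exact ⟨r + r', t + t', y + y', Submodule.add_mem _ hy hy', by module⟩
  | ι_mul x m hx =>
    have key : ∀ n, ∃ (r t : ℂ) (y : Fock),
        y ∈ ⨆ n, (xiMul (n + 1)).range ∧ xiMul n x = r • 1 + t • xi 0 + y := by
      intro n
      cases n with
      | succ k => exact ⟨0, 0, _, Submodule.mem_iSup_of_mem k ⟨x, rfl⟩, by simp⟩
      | zero =>
        obtain ⟨r, t, y, hy, rfl⟩ := hx
        refine ⟨0, r, xiMul 0 y, hxi 0 y hy, ?_⟩
        have h0 : xi 0 * xi 0 = 0 := ExteriorAlgebra.ι_sq_zero _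
        rw [map_add, map_add, map_smul, map_smul, xiMul_apply, xiMul_apply, mul_one, h0]
        module
    change ∃ (r t : ℂ) (y : Fock), y ∈ ⨆ n, (xiMul (n + 1)).range ∧
      ExteriorAlgebra.ι ℂ m * x = r • 1 + t • xi 0 + y
    clear hx
    induction m using Finsupp.induction_linear with
    | zero => exact ⟨0, 0, 0, Submodule.zero_mem _, by simp⟩
    | add m m' hm hm' =>
      obtain ⟨r, t, y, hy, h⟩ := hm
      obtain ⟨r', t', y', hy', h'⟩ := hm'
      exact ⟨r + r', t + t', y + y', Submodule.add_mem _ hy hy', by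
        rw [map_add, add_mul, h, h']; module⟩
    | single n q =>
      obtain ⟨r, t, y, hy, h⟩ := key n
      refine ⟨q * r, q * t, q • y, Submodule.smul_mem _ _ hy, ?_⟩
      have hs : Finsupp.single n q = q • Finsupp.single n (1 : ℂ) := by simp
      rw [hs, map_smul, smul_mul_assoc]
      change q • xiMul n x = _
      rw [h]
      module

/-- Since 1 and ξ₀ are themselves vacuum vectors, the remainder in `exists_vacuum_add` is a vacuum
vector in the image of the creation operators, hence zero. -/
theorem eq_of_vacuum {x : Fock} (hx : ∀ n, dxi (n + 1) x = 0) :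
    ∃ r t : ℂ, x = r • 1 + t • xi 0 := by
  obtain ⟨r, t, y, hy, rfl⟩ := exists_vacuum_add x
  have hvac : ∀ n, dxi (n + 1) (r • 1 + t • xi 0) = 0 := fun n => by
    have := dxi_xiMul (n + 1) 0 1
    rw [dxi_one, map_zero, add_zero, if_neg (by omega), xiMul_apply, mul_one] at this
    rw [map_add, map_smul, map_smul, dxi_one, this, smul_zero, smul_zero, add_zero]
  have hy0 : y = 0 := by
    refine eq_zero_of_vacuum (a := fun n => dxi (n + 1)) (c := fun n => xiMul (n + 1)) ?_ ?_ hy ?_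
    · intro m n x
      rw [dxi_xiMul]
      exact if_congr (by omega) rfl rfl
    · exact fun m n x => xiMul_xiMul _ _ x
    · intro n
      have := hx n
      rwa [map_add, hvac, zero_add] at this
  exact ⟨r, t, by rw [hy0, add_zero]⟩

theorem fockPsi_zero_one : fockPsi 0 1 = (1 / (Real.sqrt 2 : ℂ)) • xi 0 := by
  rw [fockPsi_zero, LinearMap.smul_apply, LinearMap.add_apply, dxi_one, xiMul_apply, mul_one,
    add_zero]

/-- The Fock space is generated by `1` under the `ψₙ`, `n ≤ 0`. -/
theorem fock_eq_top {W : Submodule ℂ Fock} (h1 : 1 ∈ W)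
    (hW : ∀ n ≤ 0, ∀ x ∈ W, fockPsi n x ∈ W) : W = ⊤ := by
  refine top_le_iff.1 (le_of_vacuum_le (a := fun n => dxi (n + 1)) (c := fun n => xiMul (n + 1))
    ?_ ?_ ?_ ?_ ?_ ?_ ?_)
  · intro m n x
    rw [dxi_xiMul]
    exact if_congr (by omega) rfl rfl
  · exact fun m n x => dxi_dxi _ _ x
  · exact fun _ _ _ => Submodule.mem_top
  · exact fun _ _ _ => Submodule.mem_top
  · intro n x hx
    rw [← fockPsi_neg]
    exact hW _ (by omega) x hx
  · intro x _ hx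
    obtain ⟨r, t, rfl⟩ := eq_of_vacuum hx
    have h2 := hW 0 le_rfl 1 h1
    rw [fockPsi_zero_one] at h2
    have h3 := W.smul_mem (Real.sqrt 2 : ℂ) h2
    rw [smul_smul, mul_one_div_cancel sqrt_two_ne_zero, one_smul] at h3
    exact W.add_mem (W.smul_mem _ h1) (W.smul_mem _ h3)
  · intro x _
    obtain ⟨N, hN⟩ := exists_dxi_eq_zero x
    exact ⟨N, fun n hn => hN _ (by omega)⟩

/-! ### Parity on the Fock space -/

/-- Parity becomes the main involution, an algebra homomorphism that negates the generators. -/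
theorem fock_parityOp (x : Fock) :
    fockAction.grading.parityOp x = CliffordAlgebra.involute x := by
  have h := fockAction.grading.evenProj_add_oddProj x
  have h0 := CliffordAlgebra.involute_eq_of_mem_even (fockAction.grading.evenProj_mem x)
  have h1 := CliffordAlgebra.involute_eq_of_mem_odd (fockAction.grading.oddProj_mem x)
  conv_rhs => rw [← h]
  rw [map_add, h0, h1]
  exact sub_eq_add_neg _ _

theorem fock_parityOp_xiMul (n : ℕ) (x : Fock) :
    fockAction.grading.parityOp (xiMul n x) = -xiMul n (fockAction.grading.parityOp x) := by
  rw [fock_parityOp, fock_parityOp, xiMul_apply, xiMul_apply, map_mul, xi]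
  rw [show CliffordAlgebra.involute (ExteriorAlgebra.ι ℂ (Finsupp.single n (1 : ℂ)))
    = -ExteriorAlgebra.ι ℂ (Finsupp.single n (1 : ℂ)) from CliffordAlgebra.involute_ι _, neg_mul]

theorem fock_parityOp_dxi (n : ℕ) (x : Fock) :
    fockAction.grading.parityOp (dxi n x) = -dxi n (fockAction.grading.parityOp x) := by
  rw [fock_parityOp, fock_parityOp]
  induction x using CliffordAlgebra.left_induction with
  | algebraMap r =>
    rw [AlgHom.commutes]
    have := dxi_algebraMap n r
    change dxi n (algebraMap ℂ (CliffordAlgebra _) r) = 0 at this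
    rw [this, map_zero, neg_zero]
  | add x y hx hy => rw [map_add, map_add, hx, hy, map_add, map_add, neg_add]
  | ι_mul x m hx =>
    have h1 := dxi_ι_mul n m x
    have h2 := dxi_ι_mul n m (CliffordAlgebra.involute x)
    change dxi n (CliffordAlgebra.ι _ m * x) = m n • x - CliffordAlgebra.ι _ m * dxi n x at h1
    change dxi n (CliffordAlgebra.ι _ m * CliffordAlgebra.involute x) = m n • _
      - CliffordAlgebra.ι _ m * dxi n (CliffordAlgebra.involute x) at h2
    rw [h1, map_sub, map_smul, map_mul, map_mul, CliffordAlgebra.involute_ι, hx, neg_mul, neg_mul,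
      mul_neg, map_neg, h2]
    abel

theorem fock_parityOp_fockPsi (n : ℤ) (x : Fock) :
    fockAction.grading.parityOp (fockPsi n x) = -fockPsi n (fockAction.grading.parityOp x) := by
  rcases int_cases n with rfl | ⟨k, rfl⟩ | ⟨k, rfl⟩
  · simp only [fockPsi_zero, LinearMap.smul_apply, LinearMap.add_apply, map_smul, map_add,
      fock_parityOp_xiMul, fock_parityOp_dxi]
    module
  · rw [fockPsi_pos, fock_parityOp_dxi]
  · rw [fockPsi_neg, fock_parityOp_xiMul]

theorem fock_parityOp_normalOrd (j k : ℤ) (x : Fock) :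
    fockAction.grading.parityOp (normalOrd j k x)
      = normalOrd j k (fockAction.grading.parityOp x) := by
  unfold normalOrd
  split_ifs <;> simp [fock_parityOp_fockPsi]

/-! ### The Virasoro operators on the Fock space -/

theorem fockL_apply (k : ℤ) (v : Fock) : fockL k v = (if k = 0 then (1 / 16 : ℂ) else 0) • v
    + (1 / 2 : ℂ) • ∑ᶠ j : ℤ, (j : ℂ) • normalOrd (-j) (j + k) v := rfl

/-- A linear map applied to `L̄ₖ v`, term by term. -/
theorem map_fockL (T : Module.End ℂ Fock) (k : ℤ) (v : Fock) :
    T (fockL k v) = (if k = 0 then (1 / 16 : ℂ) else 0) • T v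
      + (1 / 2 : ℂ) • ∑ᶠ j : ℤ, (j : ℂ) • T (normalOrd (-j) (j + k) v) := by
  rw [fockL_apply, map_add, map_smul, map_smul]
  congr 2
  have := T.toAddMonoidHom.map_finsum (normalOrd_finite k v)
  simpa using this

theorem map_normalOrd_finite (T : Module.End ℂ Fock) (k : ℤ) (v : Fock) :
    (Function.support fun j : ℤ => (j : ℂ) • T (normalOrd (-j) (j + k) v)).Finite := by
  refine (normalOrd_finite k v).subset fun j hj hz => hj ?_
  have hz' : (j : ℂ) • normalOrd (-j) (j + k) v = 0 := hz
  change (j : ℂ) • T _ = 0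
  rw [← map_smul, hz', map_zero]

theorem fock_parityOp_fockL (k : ℤ) (x : Fock) :
    fockAction.grading.parityOp (fockL k x) = fockL k (fockAction.grading.parityOp x) := by
  rw [map_fockL, fockL_apply]
  simp only [fock_parityOp_normalOrd]

/-- Moving ψₙ to the left past a product of two fermions produces two contractions. Their difference
is antisymmetric in a and b, so normal ordering, which swaps the factors with a sign, does not
affect it. -/
theorem normalOrd_fockPsi (a b n : ℤ) (v : Fock) :
    normalOrd a b (fockPsi n v) = fockPsi n (normalOrd a b v)
      + ((if b + n = 0 then fockPsi a v else 0) - (if a + n = 0 then fockPsi b v else 0)) := by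
  have key : ∀ a b, fockPsi a (fockPsi b (fockPsi n v)) = fockPsi n (fockPsi a (fockPsi b v))
      + ((if b + n = 0 then fockPsi a v else 0) - (if a + n = 0 then fockPsi b v else 0)) := by
    intro a b
    have h1 := congrArg (fockPsi a) (eq_sub_of_add_eq (fockPsi_fockPsi b n v))
    have h2 := eq_sub_of_add_eq (fockPsi_fockPsi a n (fockPsi b v))
    rw [h1, map_sub, h2, apply_ite (fockPsi a), map_zero]
    abel
  unfold normalOrd
  split_ifs with h
  all_goals
    simp only [Module.End.mul_apply, LinearMap.neg_apply, map_neg]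
    rw [key]
    simp_all
  all_goals abel

/-- Only the terms j = -m-n and j = n of the series fail to commute with ψₙ. They contribute
½((-m-n) - n)ψₘ₊ₙ. -/
theorem fockL_fockPsi (m n : ℤ) (v : Fock) :
    fockL m (fockPsi n v) = fockPsi n (fockL m v) + (-(n : ℂ) - m / 2) • fockPsi (m + n) v := by
  have hfin := map_normalOrd_finite (fockPsi n) m v
  have e : ∀ j : ℤ, (j : ℂ) • normalOrd (-j) (j + m) (fockPsi n v)
      = (j : ℂ) • fockPsi n (normalOrd (-j) (j + m) v)
        + ((if j = -m - n then (j : ℂ) • fockPsi (m + n) v else 0)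
          - (if j = n then (j : ℂ) • fockPsi (m + n) v else 0)) := by
    intro j
    rw [normalOrd_fockPsi, smul_add, smul_sub, smul_ite, smul_ite, smul_zero]
    congr 2
    · by_cases h : j = -m - n
      · rw [if_pos h, if_pos (by omega), show -j = m + n by omega]
      · rw [if_neg h, if_neg (by omega)]
    · by_cases h : j = n
      · rw [if_pos h, if_pos (by omega), h, add_comm]
      · rw [if_neg h, if_neg (by omega)]
  have single : ∀ (p : ℤ), (Function.support fun j : ℤ =>
      if j = p then (j : ℂ) • fockPsi (m + n) v else 0).Finite := fun p =>
    (Set.finite_singleton p).subset fun j hj => by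
      by_contra h
      exact hj (if_neg h)
  have single_sum : ∀ (p : ℤ), (∑ᶠ j : ℤ, if j = p then (j : ℂ) • fockPsi (m + n) v else 0)
      = (p : ℂ) • fockPsi (m + n) v := fun p => by
    rw [finsum_eq_single _ p fun j hj => if_neg hj, if_pos rfl]
  rw [map_fockL, fockL_apply]
  simp only [e]
  rw [finsum_add_distrib hfin ?_, finsum_sub_distrib (single _) (single _), single_sum, single_sum]
  · push_cast
    module
  · exact ((single (-m - n)).union (single n)).subset (Function.support_sub _ _)

theorem fockL_zero_normalOrd (a b : ℤ) (v : Fock) :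
    fockL 0 (normalOrd a b v) = normalOrd a b (fockL 0 v) - ((a : ℂ) + b) • normalOrd a b v := by
  have key : ∀ a b : ℤ, fockL 0 (fockPsi a (fockPsi b v)) = fockPsi a (fockPsi b (fockL 0 v))
      - ((a : ℂ) + b) • fockPsi a (fockPsi b v) := by
    intro a b
    rw [fockL_fockPsi, fockL_fockPsi]
    simp only [map_add, map_smul, zero_add, Int.cast_zero]
    module
  unfold normalOrd
  split_ifs
  · exact key a b
  · rw [LinearMap.neg_apply, LinearMap.neg_apply, map_neg]
    have := key b a
    simp only [Module.End.mul_apply]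
    rw [this]
    module

/-- Every summand of L̄ₖ has weight -k under L̄₀, so this case of the Virasoro relation holds term
by term. The constant 1/16 plays no role because it occurs only for k = 0. -/
theorem fockL_zero_fockL (k : ℤ) (v : Fock) :
    fockL 0 (fockL k v) = fockL k (fockL 0 v) - (k : ℂ) • fockL k v := by
  have hk : (k : ℂ) * (if k = 0 then (1 / 16 : ℂ) else 0) = 0 := by
    split_ifs with h <;> simp [h]
  have h1 : ∀ j : ℤ, (j : ℂ) • fockL 0 (normalOrd (-j) (j + k) v)
      = (j : ℂ) • normalOrd (-j) (j + k) (fockL 0 v)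
        - (k : ℂ) • ((j : ℂ) • normalOrd (-j) (j + k) v) := fun j => by
    rw [fockL_zero_normalOrd]
    push_cast
    module
  rw [map_fockL, fockL_apply k (fockL 0 v), fockL_apply k v]
  simp only [h1]
  rw [finsum_sub_distrib (normalOrd_finite k _)
    ((normalOrd_finite k v).subset fun j hj hz => hj (by
      change (k : ℂ) • ((j : ℂ) • normalOrd (-j) (j + k) v) = 0
      have hz' : (j : ℂ) • normalOrd (-j) (j + k) v = 0 := hz
      rw [hz', smul_zero])), ← smul_finsum]
  have hk' := congrArg (· • v) hk
  simp only [mul_smul, zero_smul] at hk'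
  simp only [smul_add, hk']
  module

/-- An even operator on the Fock space that commutes with all `ψₙ` is a scalar. -/
theorem exists_eq_smul_of_commute {T : Module.End ℂ Fock}
    (hpar : ∀ x, fockAction.grading.parityOp (T x) = T (fockAction.grading.parityOp x))
    (hT : ∀ n x, T (fockPsi n x) = fockPsi n (T x)) : ∃ r : ℂ, ∀ x, T x = r • x := by
  obtain ⟨r, t, h⟩ := eq_of_vacuum (x := T 1) fun n => by
    rw [← fockPsi_pos, ← hT, fockPsi_pos, dxi_one, map_zero]
  have hone : fockAction.grading.parityOp 1 = 1 := by rw [fock_parityOp, map_one]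
  have hxi : fockAction.grading.parityOp (xi 0) = -xi 0 := by
    have := fock_parityOp_xiMul 0 1
    rwa [hone, xiMul_apply, mul_one] at this
  have h2 := hpar 1
  rw [hone, h, map_add, map_smul, map_smul, hone, hxi, smul_neg, add_right_inj] at h2
  -- Evenness of T enters here: the ξ₀ component of T 1 is its own negative. Without evenness the
  -- statement fails, as the composite of the parity operator with ξ₀ - ∂/∂ξ₀ commutes with all ψₙ.
  have ht : t • xi 0 = 0 := by
    have h3 : (2 : ℂ) • t • xi 0 = 0 := by
      rw [two_smul]
      nth_rewrite 1 [← h2]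
      exact neg_add_cancel _
    exact (smul_eq_zero.1 h3).resolve_left two_ne_zero
  rw [ht, add_zero] at h
  refine ⟨r, fun x => ?_⟩
  have : LinearMap.eqLocus T (r • LinearMap.id) = ⊤ := by
    refine fock_eq_top (by simpa using h) fun n _ x hx => ?_
    simp only [LinearMap.mem_eqLocus, LinearMap.smul_apply, LinearMap.id_apply] at hx ⊢
    rw [hT, hx, map_smul]
  have hx : x ∈ LinearMap.eqLocus T (r • LinearMap.id) := this ▸ Submodule.mem_top
  simpa using hx

/-! ### Values of the Virasoro operators on the vacuum -/

theorem fockPsi_one_of_pos {n : ℤ} (hn : 0 < n) : fockPsi n 1 = 0 := by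
  rw [fockPsi, if_pos hn, dxi_one]

theorem normalOrd_one_of_pos {j k : ℤ} (h : 0 < j ∨ 0 < k) : normalOrd j k 1 = 0 := by
  unfold normalOrd
  split_ifs
  · rw [Module.End.mul_apply, fockPsi_one_of_pos (by omega), map_zero]
  · rw [LinearMap.neg_apply, Module.End.mul_apply, fockPsi_one_of_pos (by omega), map_zero,
      neg_zero]

theorem fockL_one_of_pos {k : ℤ} (hk : 0 < k) : fockL k 1 = 0 := by
  rw [fockL_apply, if_neg hk.ne', zero_smul, zero_add]
  have h : ∀ j : ℤ, normalOrd (-j) (j + k) 1 = 0 := fun j => normalOrd_one_of_pos (by omega)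
  simp only [h, smul_zero, finsum_zero]

theorem fockL_zero_one : fockL 0 1 = (1 / 16 : ℂ) • 1 := by
  have h : ∀ j : ℤ, (j : ℂ) • normalOrd (-j) j 1 = 0 := fun j => by
    rcases eq_or_ne j 0 with rfl | hj
    · simp
    · rw [normalOrd_one_of_pos (by omega), smul_zero]
  rw [fockL_apply, if_pos rfl]
  simp only [add_zero, h, finsum_zero, smul_zero]

theorem fockL_neg_one_one : fockL (-1) 1 = (1 / 2 : ℂ) • fockPsi (-1) (fockPsi 0 1) := by
  rw [fockL_apply, if_neg (by omega), zero_smul, zero_add, finsum_eq_single _ 1]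
  · simp [normalOrd]
  · intro j hj
    rcases eq_or_ne j 0 with rfl | hj
    · simp
    · rw [normalOrd_one_of_pos (by omega), smul_zero]

/-- Only j = 0, 1, 2 could contribute. The first has coefficient 0, the second is ψ₋₁² = 0, and the
third has coefficient ½ · 2. -/
theorem fockL_neg_two_one : fockL (-2) 1 = fockPsi (-2) (fockPsi 0 1) := by
  rw [fockL_apply, if_neg (by omega), zero_smul, zero_add, finsum_eq_single _ 2]
  · simp [normalOrd]
  · intro j hj
    rcases eq_or_ne j 0 with rfl | hj
    · simp
    rcases eq_or_ne j 1 with rfl | hj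
    · have h := fockPsi_fockPsi (-1) (-1) 1
      rw [if_neg (by omega), ← two_smul ℂ, smul_eq_zero] at h
      simp [normalOrd, h.resolve_left two_ne_zero]
    · rw [normalOrd_one_of_pos (by omega), smul_zero]

/-- The defect of the relation `[Lₘ, Lₙ] = (m - n) Lₘ₊ₙ` on the Fock space. -/
def fockDefect (m n : ℤ) : Module.End ℂ Fock :=
  fockL m * fockL n - fockL n * fockL m - ((m : ℂ) - n) • fockL (m + n)

theorem fockL_mul_fockL (m n : ℤ) (x : Fock) : fockL m (fockL n x) = fockL n (fockL m x)
    + ((m : ℂ) - n) • fockL (m + n) x + fockDefect m n x := by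
  simp only [fockDefect, LinearMap.sub_apply, Module.End.mul_apply, LinearMap.smul_apply]
  abel

theorem fockDefect_apply (m n : ℤ) (x : Fock) : fockDefect m n x = fockL m (fockL n x)
    - fockL n (fockL m x) - ((m : ℂ) - n) • fockL (m + n) x := rfl

/-- The two sides of the Virasoro relation have equal commutators with every ψₖ, because the
coefficients -k - m/2 define a representation of the centreless relations. The defect is even and
commutes with all fermions. -/
theorem exists_fockDefect (m n : ℤ) : ∃ r : ℂ, ∀ x, fockDefect m n x = r • x := by
  refine exists_eq_smul_of_commute (fun x => ?_) fun k x => ?_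
  · simp only [fockDefect_apply, map_sub, map_smul, fock_parityOp_fockL]
  · simp only [fockDefect_apply, map_sub, map_smul, fockL_fockPsi, map_add]
    rw [show n + (m + k) = m + (n + k) by ring, show m + n + k = m + (n + k) by ring]
    push_cast
    module

/-- The defect has weight -(m + n) under L̄₀, whereas a scalar has weight 0. -/
theorem fockDefect_of_add_ne_zero {m n : ℤ} (h : m + n ≠ 0) (x : Fock) : fockDefect m n x = 0 := by
  obtain ⟨r, hr⟩ := exists_fockDefect m n
  have key : fockL 0 (fockDefect m n x) = fockDefect m n (fockL 0 x)
      - ((m : ℂ) + n) • fockDefect m n x := by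
    simp only [fockDefect_apply, map_sub, map_smul, fockL_zero_fockL]
    push_cast
    module
  rw [hr, hr, map_smul, eq_comm, sub_eq_self, ← hr, smul_eq_zero] at key
  exact key.resolve_left (by exact_mod_cast h)

/-- The scalar by which `[Lₘ, L₋ₘ] - 2m L₀` acts on the Fock space. -/
def fockCocycle (m : ℤ) : ℂ := (exists_fockDefect m (-m)).choose

theorem fockDefect_neg (m : ℤ) (x : Fock) : fockDefect m (-m) x = fockCocycle m • x :=
  (exists_fockDefect m (-m)).choose_spec x

theorem eq_of_smul_one {r t : ℂ} (h : r • (1 : Fock) = t • 1) : r = t := by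
  rw [← Algebra.algebraMap_eq_smul_one, ← Algebra.algebraMap_eq_smul_one] at h
  exact ExteriorAlgebra.algebraMap_leftInverse (R := ℂ) (ℕ →₀ ℂ) |>.injective h

theorem fockCocycle_neg (m : ℤ) : fockCocycle (-m) = -fockCocycle m := by
  refine eq_of_smul_one ?_
  rw [neg_smul, ← fockDefect_neg, ← fockDefect_neg, neg_neg, fockDefect_apply, fockDefect_apply,
    neg_add_cancel, add_neg_cancel]
  push_cast
  module

theorem fockPsi_zero_zero (x : Fock) : fockPsi 0 (fockPsi 0 x) = (1 / 2 : ℂ) • x := by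
  have h := fockPsi_fockPsi 0 0 x
  rw [if_pos (add_zero _), ← two_smul ℂ] at h
  rw [eq_comm, ← inv_smul_eq_iff₀ two_ne_zero] at h
  rw [← h, one_div]

/-- On the vacuum L̄₁L̄₋₁ gives ½ · ½ · ψ₀² = 1/8, which 2L̄₀ cancels: this is the role of the
constant 1/16. -/
theorem fockCocycle_one : fockCocycle 1 = 0 := by
  refine eq_of_smul_one ?_
  rw [← fockDefect_neg, fockDefect_apply, fockL_neg_one_one, fockL_one_of_pos one_pos]
  simp only [map_smul, fockL_fockPsi, fockL_one_of_pos one_pos, map_zero, zero_add, add_zero,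
    fockPsi_one_of_pos one_pos, smul_zero]
  rw [show (1 : ℤ) + -1 = 0 by norm_num, fockPsi_zero_zero, fockL_zero_one]
  push_cast
  module

/-- On the vacuum L̄₂L̄₋₂ gives ψ₀² = 1/2, and 4L̄₀ gives 4/16. -/
theorem fockCocycle_two : fockCocycle 2 = 1 / 4 := by
  refine eq_of_smul_one ?_
  rw [← fockDefect_neg, fockDefect_apply, fockL_neg_two_one, fockL_one_of_pos two_pos]
  simp only [fockL_fockPsi, fockL_one_of_pos two_pos, map_zero, zero_add, add_zero,
    fockPsi_one_of_pos two_pos, smul_zero]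
  rw [show (2 : ℤ) + -2 = 0 by norm_num, fockPsi_zero_zero, fockL_zero_one]
  push_cast
  module

/-- The Jacobi identity for `L₁`, `Lₘ`, `L₋ₘ₋₁`. -/
theorem fockCocycle_succ {m : ℤ} (hm : 1 < m) :
    ((m : ℂ) - 1) * fockCocycle (m + 1) = (m + 2) * fockCocycle m := by
  have h : ∀ a b : ℤ, a + b ≠ 0 → fockL a * fockL b - fockL b * fockL a
      = ((a : ℂ) - b) • fockL (a + b) := fun a b hab => by
    refine LinearMap.ext fun x => ?_
    exact sub_eq_zero.1 (fockDefect_of_add_ne_zero hab x)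
  have h' : ∀ a b : ℤ, b = -a → fockL a * fockL b - fockL b * fockL a
      = (2 * (a : ℂ)) • fockL 0 + fockCocycle a • LinearMap.id := by
    rintro a b rfl
    refine LinearMap.ext fun x => ?_
    have := fockL_mul_fockL a (-a) x
    rw [fockDefect_neg, add_neg_cancel] at this
    simp only [LinearMap.sub_apply, Module.End.mul_apply, LinearMap.add_apply,
      LinearMap.smul_apply, LinearMap.id_apply, this]
    push_cast
    module
  have jacobi : ∀ a b c : Module.End ℂ Fock, a * (b * c - c * b) - (b * c - c * b) * a
      + (b * (c * a - a * c) - (c * a - a * c) * b)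
      + (c * (a * b - b * a) - (a * b - b * a) * c) = 0 := fun a b c => by
    simp only [mul_sub, sub_mul, mul_assoc]
    abel
  have comm_smul : ∀ (t : ℂ) (a b : Module.End ℂ Fock),
      a * t • b - t • b * a = t • (a * b - b * a) := fun t a b => by
    rw [mul_smul_comm, smul_mul_assoc]
    exact (smul_sub t (a * b) (b * a)).symm
  have J := jacobi (fockL 1) (fockL m) (fockL (-m - 1))
  -- The inner brackets have total modes -1, -m and m + 1, all nonzero since m > 1, so they carry no
  -- scalar. The outer brackets have total mode 0, and there the scalars enter.
  rw [h m (-m - 1) (by omega), h (-m - 1) 1 (by omega), h 1 m (by omega)] at J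
  simp only [comm_smul] at J
  rw [h' 1 (m + (-m - 1)) (by ring), h' m (-m - 1 + 1) (by ring), add_comm 1 m,
    ← neg_sub (fockL (m + 1) * _), h' (m + 1) (-m - 1) (by ring), fockCocycle_one] at J
  have J1 := LinearMap.congr_fun J 1
  simp only [LinearMap.add_apply, LinearMap.smul_apply, LinearMap.neg_apply, LinearMap.id_apply,
    LinearMap.zero_apply, fockL_zero_one] at J1
  push_cast at J1
  refine eq_of_smul_one ?_
  rw [← sub_eq_zero, ← J1]
  module

/-- The recursion has the factor m - 1 on its left side and cannot pass from 1 to 2, so the value at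
2 is a separate input. -/
theorem fockCocycle_natCast (m : ℕ) : fockCocycle m = ((m : ℂ) ^ 3 - m) / 24 := by
  rcases Nat.lt_or_ge m 2 with h | h
  · interval_cases m
    · have := fockCocycle_neg 0
      rw [neg_zero, eq_neg_iff_add_eq_zero, ← two_mul] at this
      simpa using this
    · rw [Nat.cast_one, fockCocycle_one]
      norm_num
  · induction m, h using Nat.le_induction with
    | base =>
      rw [Nat.cast_ofNat, fockCocycle_two]
      norm_num
    | succ m hm ih =>
      have key := fockCocycle_succ (m := m) (by omega)
      have hne : (m : ℂ) - 1 ≠ 0 := sub_ne_zero.2 (by exact_mod_cast (by omega : m ≠ 1))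
      rw [ih] at key
      refine mul_left_cancel₀ hne ?_
      push_cast at key ⊢
      rw [key]
      ring

theorem fockCocycle_eq (m : ℤ) : fockCocycle m = ((m : ℂ) ^ 3 - m) / 24 := by
  obtain ⟨n, rfl | rfl⟩ := m.eq_nat_or_neg
  · exact_mod_cast fockCocycle_natCast n
  · rw [fockCocycle_neg, fockCocycle_natCast]
    push_cast
    ring

/-- The operators `L̄ₖ` satisfy the relations of the Virasoro algebra with central charge `1/2`. -/
theorem fockL_fockL (m n : ℤ) (x : Fock) : fockL m (fockL n x) = fockL n (fockL m x)
    + ((m : ℂ) - n) • fockL (m + n) x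
    + (if m + n = 0 then ((m : ℂ) ^ 3 - m) / 12 else 0) • (1 / 2 : ℂ) • x := by
  rw [fockL_mul_fockL]
  congr 1
  split_ifs with h
  · obtain rfl : n = -m := by omega
    rw [fockDefect_neg, fockCocycle_eq]
    module
  · rw [fockDefect_of_add_ne_zero h, zero_smul]

/-! ### The Fock space as an `S`-module -/

section

variable (r : ℂ)

theorem fock_act_L (k : ℤ) : (fockAction.twist (sigma r)).act (S.e (.L k)) = fockL k := by
  simp [SuperAction.twist, fockAction, sigma, S.e]

theorem fock_act_psi (n : ℤ) :
    (fockAction.twist (sigma r)).act (S.e (.psi n)) = r • fockPsi n := by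
  simp [SuperAction.twist, fockAction, sigma, S.e]

theorem fock_act_c :
    (fockAction.twist (sigma r)).act (S.e .c) = (1 / 2 : ℂ) • LinearMap.id := by
  simp [SuperAction.twist, fockAction, sigma, S.e]

theorem fock_act_z : (fockAction.twist (sigma r)).act (S.e .z) = r ^ 2 • LinearMap.id := by
  simp [SuperAction.twist, fockAction, sigma, S.e]

theorem fock_isModule : (fockAction.twist (sigma r)).IsModule := by
  refine SuperAction.isModule_of_basis _ (fun a j v hv => ?_) fun a b v => ?_
  · change v ∈ fockAction.grading.part j at hv
    change _ ∈ fockAction.grading.part _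
    cases a with
    | L k =>
      simp only [fock_act_L, SIdx.parity, zero_add]
      exact SuperGrading.map_mem_of_parityOp _ _ (fock_parityOp_fockL k) j hv
    | psi n =>
      rw [fock_act_psi, SIdx.parity]
      exact Submodule.smul_mem _ _
        (SuperGrading.map_mem_of_parityOp_neg _ _ (fock_parityOp_fockPsi n) j hv)
    | c =>
      simp only [fock_act_c, SIdx.parity, zero_add]
      exact Submodule.smul_mem _ _ hv
    | z =>
      simp only [fock_act_z, SIdx.parity, zero_add]
      exact Submodule.smul_mem _ _ hv
  · cases a <;> cases b <;>
      simp only [S.basisBracket, SIdx.parity, koszul_zero_left, koszul_zero_right, koszul_one_one,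
        map_add, map_smul, map_neg, map_zero, fock_act_L, fock_act_psi, fock_act_c, fock_act_z,
        LinearMap.add_apply, LinearMap.smul_apply, LinearMap.neg_apply, LinearMap.zero_apply,
        LinearMap.id_apply, one_smul]
    case L.L m n =>
      rw [fockL_fockL m n]
      abel
    case L.psi m n =>
      rw [fockL_fockPsi]
      module
    case psi.L n m =>
      rw [fockL_fockPsi]
      module
    case psi.psi m n =>
      have h := fockPsi_fockPsi m n v
      rw [neg_smul, one_smul, sub_neg_eq_add, ← smul_add, ← smul_add, h]
      split_ifs
      · module
      · simp
    all_goals module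

end

/-! ### Weights of `S`-modules -/

/-- The operator of a basis element lowers the eigenvalues of `L₀` by its mode. -/
def SIdx.mode : SIdx → ℤ
  | .L m => m
  | .psi n => n
  | _ => 0

namespace SuperAction

variable {V : Type*} [AddCommGroup V] [Module ℂ V] {A : SuperAction S V}

/-- The weight spaces of an `S`-module. -/
abbrev weightSpace (A : SuperAction S V) (β : ℂ) : Submodule ℂ V :=
  Module.End.eigenspace (A.act (S.e (.L 0))) β

theorem IsModule.act_mem_weightSpace (h : A.IsModule) (a : SIdx) {β : ℂ} {v : V}
    (hv : v ∈ A.weightSpace β) : A.act (S.e a) v ∈ A.weightSpace (β - a.mode) := by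
  rw [Module.End.mem_eigenspace_iff] at hv ⊢
  have hb := h.basis_bracket (.L 0) a v
  rw [show (SIdx.L 0).parity = 0 from rfl, koszul_zero_left, one_smul, hv, map_smul] at hb
  have hm : S.basisBracket (.L 0) a = -(a.mode : ℂ) • S.e a := by
    cases a <;> simp [S.basisBracket, SIdx.mode]
  rw [hm, map_smul, LinearMap.smul_apply] at hb
  rw [eq_add_of_sub_eq hb.symm]
  module

theorem IsHighestWeight.exists_lowest (hhw : A.IsHighestWeight) [Nontrivial V] :
    ∃ β, A.weightSpace β ≠ ⊥ ∧ ∀ n : ℕ, 0 < n → A.weightSpace (β - n) = ⊥ := by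
  obtain ⟨htop, α, hα⟩ := hhw
  have hex : ∃ k : ℕ, A.weightSpace (α + k) ≠ ⊥ := by
    by_contra! hcon
    have : (⨆ β : ℂ, A.weightSpace β) = ⊥ := iSup_eq_bot.2 fun β => by
      by_contra hβ
      obtain ⟨n, rfl⟩ := hα β hβ
      exact hβ (hcon n)
    exact bot_ne_top (this.symm.trans htop)
  classical
  refine ⟨α + Nat.find hex, Nat.find_spec hex, fun n hn => ?_⟩
  by_contra hne
  obtain ⟨k, hk⟩ := hα _ hne
  have hk' : ((Nat.find hex : ℕ) : ℂ) = ((k + n : ℕ) : ℂ) := by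
    push_cast
    linear_combination hk
  have hlt : k < Nat.find hex := by
    have := Nat.cast_injective hk'
    omega
  refine Nat.find_min hex hlt ?_
  rwa [← hk]

/-- ψₙ lowers the weight by n, and no weight lies below α. This supplies the finiteness needed to
apply `le_of_vacuum_le` to V. -/
theorem exists_psi_eq_zero (h : A.IsModule) (hhw : A.IsHighestWeight) (v : V) :
    ∃ N : ℕ, ∀ n : ℕ, N ≤ n → A.act (S.e (.psi n)) v = 0 := by
  obtain ⟨htop, α, hα⟩ := hhw
  have hv : v ∈ ⨆ β : ℂ, A.weightSpace β := htop ▸ Submodule.mem_top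
  induction hv using Submodule.iSup_induction' with
  | zero => exact ⟨0, fun n _ => map_zero _⟩
  | add x y _ _ hx hy =>
    obtain ⟨N, hN⟩ := hx
    obtain ⟨K, hK⟩ := hy
    exact ⟨max N K, fun n hn => by
      rw [map_add, hN n (le_of_max_le_left hn), hK n (le_of_max_le_right hn), add_zero]⟩
  | mem β x hx =>
    by_cases hβ : A.weightSpace β = ⊥
    · rw [hβ, Submodule.mem_bot] at hx
      exact ⟨0, fun n _ => by rw [hx, map_zero]⟩
    obtain ⟨k, rfl⟩ := hα β hβ
    refine ⟨k + 1, fun n hn => ?_⟩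
    have hmem := h.act_mem_weightSpace (.psi n) hx
    by_contra hne
    obtain ⟨j, hj⟩ := hα _ (Submodule.ne_bot_iff _ |>.2 ⟨_, hmem, hne⟩)
    have hj' : (k : ℂ) = ((j + n : ℕ) : ℂ) := by
      have hm : ((SIdx.mode (.psi n) : ℤ) : ℂ) = n := by simp [SIdx.mode]
      rw [hm] at hj
      push_cast
      linear_combination hj
    have := Nat.cast_injective hj'
    omega

/-- The vectors obtained from `u` by operators of basis elements of nonpositive mode. -/
inductive Reachable (A : SuperAction S V) (u : V) : V → Prop
  | base : Reachable A u u
  | step (a : SIdx) (v : V) : a.mode ≤ 0 → Reachable A u v → Reachable A u (A.act (S.e a) v)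

theorem Reachable.exists_mem_part (h : A.IsModule) {u v : V} (hv : A.Reachable u v)
    (hu : ∃ i, u ∈ A.grading.part i) : ∃ i, v ∈ A.grading.part i := by
  induction hv with
  | base => exact hu
  | step a v _ _ ih =>
    obtain ⟨i, hi⟩ := ih
    exact ⟨_, h.basis_mem a hi⟩

theorem Reachable.exists_mem_weightSpace (h : A.IsModule) {u v : V} (hv : A.Reachable u v) {γ : ℂ}
    (hu : u ∈ A.weightSpace γ) : ∃ k : ℕ, v ∈ A.weightSpace (γ + k) := by
  induction hv with
  | base => exact ⟨0, by simpa using hu⟩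
  | step a v ha _ ih =>
    obtain ⟨k, hk⟩ := ih
    refine ⟨k + (-a.mode).toNat, ?_⟩
    have h1 := h.act_mem_weightSpace a hk
    have h2 : (((-a.mode).toNat : ℕ) : ℂ) = -(a.mode : ℂ) := by
      have : (((-a.mode).toNat : ℕ) : ℤ) = -a.mode := Int.toNat_of_nonneg (by omega)
      exact_mod_cast this
    rwa [Nat.cast_add, h2, ← add_assoc, ← sub_eq_add_neg]

/-- A substitute for a Poincaré–Birkhoff–Witt argument: b a v equals ± a b v plus [b, a] v, and the
induction hypothesis for v, taken for all basis elements at once, covers both terms. -/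
theorem Reachable.act_mem_span (h : A.IsModule) {u v : V}
    (hu : ∀ a : SIdx, 0 < a.mode → A.act (S.e a) u = 0) (hv : A.Reachable u v) (b : SIdx) :
    A.act (S.e b) v ∈ Submodule.span ℂ {w | A.Reachable u w} := by
  induction hv generalizing b with
  | base =>
    rcases lt_or_ge 0 b.mode with hb | hb
    · rw [hu b hb]
      exact Submodule.zero_mem _
    · exact Submodule.subset_span (s := {w | A.Reachable u w}) (Reachable.step b u hb .base)
  | step a v ha hv ih =>
    have hstep : Submodule.span ℂ {w | A.Reachable u w}
        ≤ (Submodule.span ℂ {w | A.Reachable u w}).comap (A.act (S.e a)) :=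
      Submodule.span_le.2 fun w hw => Submodule.subset_span (Reachable.step a w ha hw)
    rw [eq_add_of_sub_eq (h.basis_bracket b a v).symm]
    refine Submodule.add_mem _ ?_ (Submodule.smul_mem _ _ (hstep (ih b)))
    exact S.mem_of_basis (f := A.act.flip v) (fun b => ih b) _

/-- In a simple module, a homogeneous singular vector of weight above a nonzero weight is zero. -/
theorem eq_zero_of_singular (h : A.IsModule) (hs : A.IsSimple) {β : ℂ}
    (hβ : A.weightSpace β ≠ ⊥) {n : ℕ} (hn : 0 < n) {u : V} (hu : u ∈ A.weightSpace (β + n))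
    (hui : ∃ i, u ∈ A.grading.part i)
    (hsing : ∀ a : SIdx, 0 < a.mode → A.act (S.e a) u = 0) : u = 0 := by
  set U := Submodule.span ℂ {w | A.Reachable u w} with hU
  have huU : u ∈ U := Submodule.subset_span .base
  have hstable : ∀ x : S, ∀ v ∈ U, A.act x v ∈ U := by
    intro x v hv
    refine S.mem_of_basis (f := A.act.flip v) (fun b => ?_) x
    have : U ≤ U.comap (A.act (S.e b)) :=
      Submodule.span_le.2 fun w hw => Reachable.act_mem_span h hsing hw b
    exact this hv
  rcases hs.2 U (A.grading.isGraded_span fun w hw => Reachable.exists_mem_part h hw hui) hstable with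
    hbot | htop
  · rw [hbot] at huU
    exact huU
  · exfalso
    -- All weights of U lie in β + n + ℕ with n > 0, so U misses the weight β. If U were V,
    -- independence of the eigenspaces would force the β-weight space to vanish.
    have hle : U ≤ ⨆ (γ : ℂ) (_ : γ ≠ β), A.weightSpace γ := by
      refine Submodule.span_le.2 fun w hw => ?_
      obtain ⟨k, hk⟩ := Reachable.exists_mem_weightSpace h hw hu
      refine Submodule.mem_iSup_of_mem (β + n + k) (Submodule.mem_iSup_of_mem ?_ hk)
      intro e
      have : ((n + k : ℕ) : ℂ) = 0 := by
        push_cast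
        linear_combination e
      have := Nat.cast_eq_zero.1 this
      omega
    have hind := Module.End.eigenspaces_iSupIndep (A.act (S.e (.L 0))) β
    rw [htop, top_le_iff] at hle
    rw [hle, disjoint_top] at hind
    exact hβ hind

/-! ### Modules on which `z` acts by zero -/

/-- Positive modes kill the lowest weight space. Since ψ₀² = 0 there is a homogeneous w in it killed
by ψ₀, and the negative modes of w vanish one after another because each ψ₋ₙ w is singular. -/
theorem exists_psi_annihilated (h : A.IsModule) (hs : A.IsSimple) (hhw : A.IsHighestWeight)
    (hz : ∀ v, A.act (S.e .z) v = 0) : ∃ w : V, w ≠ 0 ∧ ∀ n, A.act (S.e (.psi n)) w = 0 := by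
  have := hs.1
  obtain ⟨β, hβ, hlow⟩ := hhw.exists_lowest
  have hψ : ∀ m n v, A.act (S.e (.psi m)) (A.act (S.e (.psi n)) v)
      = -A.act (S.e (.psi n)) (A.act (S.e (.psi m)) v) := fun m n v => by
    rw [eq_neg_iff_add_eq_zero, h.psi_psi, hz, ite_self]
  have hkill : ∀ v ∈ A.weightSpace β, ∀ a : SIdx, 0 < a.mode → A.act (S.e a) v = 0 := by
    intro v hv a ha
    have h1 := h.act_mem_weightSpace a hv
    have h2 : ((a.mode.toNat : ℕ) : ℂ) = (a.mode : ℂ) := by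
      have : ((a.mode.toNat : ℕ) : ℤ) = a.mode := Int.toNat_of_nonneg ha.le
      exact_mod_cast this
    rw [← h2, hlow _ (by omega)] at h1
    exact h1
  have hpar : ∀ v ∈ A.weightSpace β, A.grading.parityOp v ∈ A.weightSpace β := by
    intro v hv
    rw [Module.End.mem_eigenspace_iff] at hv ⊢
    rw [← A.grading.parityOp_map A.grading (fun i w hw => by
      have := h.basis_mem (.L 0) hw
      rwa [show (SIdx.L 0).parity = 0 from rfl, zero_add] at this), hv, map_smul]
  obtain ⟨v, hv, hv0, i, hi⟩ : ∃ v ∈ A.weightSpace β, v ≠ 0 ∧ ∃ i, v ∈ A.grading.part i := by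
    obtain ⟨v, hv, hv0⟩ := Submodule.exists_mem_ne_zero_of_ne_bot hβ
    -- If v + Pv = 0 for the parity operator P, then v is odd; otherwise v + Pv is a nonzero even
    -- vector of the same weight.
    by_cases he : v + A.grading.parityOp v = 0
    · exact ⟨v, hv, hv0, 1, A.grading.parityOp_eq_neg_iff.1 (eq_neg_of_add_eq_zero_right he)⟩
    · refine ⟨_, Submodule.add_mem _ hv (hpar v hv), he, 0, ?_⟩
      rw [A.grading.add_parityOp]
      exact Submodule.smul_mem _ _ (A.grading.evenProj_mem v)
  obtain ⟨w, hw, hw0, ⟨j, hj⟩, hψw⟩ : ∃ w ∈ A.weightSpace β, w ≠ 0 ∧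
      (∃ i, w ∈ A.grading.part i) ∧ A.act (S.e (.psi 0)) w = 0 := by
    by_cases h0 : A.act (S.e (.psi 0)) v = 0
    · exact ⟨v, hv, hv0, ⟨i, hi⟩, h0⟩
    · refine ⟨_, ?_, h0, ⟨_, h.basis_mem (.psi 0) hi⟩, ?_⟩
      · simpa [SIdx.mode] using h.act_mem_weightSpace (.psi 0) hv
      · have := hψ 0 0 v
        rw [eq_neg_iff_add_eq_zero, ← two_smul ℂ, smul_eq_zero] at this
        exact this.resolve_left two_ne_zero
  have hneg : ∀ n : ℕ, A.act (S.e (.psi (-n))) w = 0 := by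
    intro n
    induction n using Nat.strong_induction_on with
    | _ n ih =>
      rcases Nat.eq_zero_or_pos n with rfl | hn
      · exact hψw
      refine eq_zero_of_singular h hs hβ hn ?_ ⟨_, h.basis_mem (.psi (-n)) hj⟩ fun a ha => ?_
      · simpa [SIdx.mode] using h.act_mem_weightSpace (.psi (-n)) hw
      · cases a with
        | L m =>
          -- The commutator is a multiple of ψₘ₋ₙ, which kills w by positivity of its mode or, as m
          -- > 0, by the induction hypothesis.
          rw [h.L_psi, hkill w hw _ ha, map_zero, zero_add]
          change 0 < m at ha
          rcases lt_or_ge 0 (m + -(n : ℤ)) with hlt | hle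
          · rw [hkill w hw (.psi _) hlt, smul_zero]
          · have := ih (-(m + -(n : ℤ))).toNat (by omega)
            rw [show -(((-(m + -(n : ℤ))).toNat : ℕ) : ℤ) = m + -(n : ℤ) by omega] at this
            rw [this, smul_zero]
        | psi m => rw [hψ, hkill w hw _ ha, map_zero, neg_zero]
        | c => exact absurd ha (lt_irrefl _)
        | z => exact hz _
  refine ⟨w, hw0, fun n => ?_⟩
  rcases lt_or_ge 0 n with hn | hn
  · exact hkill w hw (.psi n) hn
  · have := hneg (-n).toNat
    rwa [show -(((-n).toNat : ℕ) : ℤ) = n by omega] at this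

/-- The common kernel of the ψₙ is graded, because each ψₙ is odd, and stable under Lₘ, because [Lₘ,
ψₙ] is a multiple of ψₘ₊ₙ. It is nonzero by `exists_psi_annihilated`. -/
theorem psi_eq_zero (h : A.IsModule) (hs : A.IsSimple) (hhw : A.IsHighestWeight)
    (hz : ∀ v, A.act (S.e .z) v = 0) (n : ℤ) (v : V) : A.act (S.e (.psi n)) v = 0 := by
  obtain ⟨w, hw0, hw⟩ := exists_psi_annihilated h hs hhw hz
  let N : Submodule ℂ V := ⨅ n : ℤ, (A.act (S.e (.psi n))).ker
  have hN : ∀ {v}, v ∈ N ↔ ∀ n, A.act (S.e (.psi n)) v = 0 := by simp [N, Submodule.mem_iInf]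
  have hgr : A.grading.IsGraded N := A.grading.isGraded_of_parityOp_mem fun v hv => hN.2 fun n => by
    rw [← neg_eq_zero, ← h.parityOp_psi, hN.1 hv, map_zero]
  have hst : ∀ x : S, ∀ v ∈ N, A.act x v ∈ N := by
    intro x v hv
    refine S.mem_of_basis (f := A.act.flip v) (fun b => hN.2 fun n => ?_) x
    change A.act (S.e (.psi n)) (A.act (S.e b) v) = 0
    have hv' := hN.1 hv
    cases b with
    | L m =>
      have := h.L_psi m n v
      rwa [hv', hv', map_zero, smul_zero, add_zero, eq_comm] at this
    | psi m => rw [hv', map_zero]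
    | c =>
      have := h.basis_bracket .c (.psi n) v
      simp only [S.basisBracket, map_zero, LinearMap.zero_apply, hv', SIdx.parity,
        koszul_zero_left, one_smul, zero_sub] at this
      exact neg_eq_zero.1 this.symm
    | z => rw [hz, map_zero]
  rcases hs.2 N hgr hst with hbot | htop
  · have : w ∈ N := hN.2 hw
    rw [hbot] at this
    exact absurd this hw0
  · exact hN.1 (htop ▸ Submodule.mem_top) n

theorem fermion_eq_zero (h : A.IsModule) (hs : A.IsSimple) (hhw : A.IsHighestWeight)
    (hz : ∀ v, A.act (S.e .z) v = 0) (x : S) (hx : x ∈ fermion) (v : V) : A.act x v = 0 := by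
  have : fermion ≤ (A.act.flip v).ker := by
    refine Submodule.span_le.2 ?_
    rintro _ (⟨n, rfl⟩ | rfl)
    · exact psi_eq_zero h hs hhw hz n v
    · exact hz v
  exact this hx

/-- When F acts by zero the whole action is even, so the odd part is a submodule, hence 0 or V. The
parity operator is then ±1 and every subspace is graded. -/
theorem eq_bot_or_eq_top_of_virStable (h : A.IsModule) (hs : A.IsSimple)
    (hF : ∀ x ∈ fermion, ∀ v, A.act x v = 0) {N : Submodule ℂ V}
    (hN : ∀ x : Vir, ∀ v ∈ N, A.act (virIncl x) v ∈ N) : N = ⊥ ∨ N = ⊤ := by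
  have hψ : ∀ n v, A.act (S.e (.psi n)) v = 0 := fun n v =>
    hF _ (Submodule.subset_span (Or.inl ⟨n, rfl⟩)) v
  have hz : ∀ v, A.act (S.e .z) v = 0 := fun v => hF _ (Submodule.subset_span (Or.inr rfl)) v
  have hodd : A.grading.part 1 = ⊥ ∨ A.grading.part 1 = ⊤ := by
    refine hs.2 _ (A.grading.isGraded_of_parityOp_mem fun v hv => ?_) fun x v hv => ?_
    · rw [A.grading.parityOp_odd hv]
      exact Submodule.neg_mem _ hv
    · refine S.mem_of_basis (f := A.act.flip v) (fun b => ?_) x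
      change A.act (S.e b) v ∈ _
      cases b with
      | psi n => rw [hψ]; exact Submodule.zero_mem _
      | L n => simpa [SIdx.parity] using h.basis_mem (.L n) hv
      | c => simpa [SIdx.parity] using h.basis_mem .c hv
      | z => simpa [SIdx.parity] using h.basis_mem .z hv
  refine hs.2 N (A.grading.isGraded_of_parityOp_mem fun v hv => ?_) fun x v hv => ?_
  · rcases hodd with ho | ho
    · have : v ∈ A.grading.part 0 := by
        have := A.grading.isCompl.sup_eq_top
        rw [ho, sup_bot_eq] at this
        exact this ▸ Submodule.mem_top
      rwa [A.grading.parityOp_even this]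
    · rw [A.grading.parityOp_odd (ho ▸ Submodule.mem_top)]
      exact N.neg_mem hv
  · refine S.mem_of_basis (f := A.act.flip v) (fun b => ?_) x
    change A.act (S.e b) v ∈ _
    cases b with
    | psi n => rw [hψ]; exact N.zero_mem
    | z => rw [hz]; exact N.zero_mem
    | L n => simpa [virIncl_e, VirIdx.toSIdx] using hN (Vir.e (.L n)) v hv
    | c => simpa [virIncl_e, VirIdx.toSIdx] using hN (Vir.e .c) v hv

end SuperAction

/-! ### The Virasoro module when F acts by zero -/

theorem isIrreducible_of_submodule {M : Type*} [AddCommGroup M] [Module ℂ M]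
    [LieRingModule Vir M] [LieModule ℂ Vir M] [Nontrivial M]
    (h : ∀ N : Submodule ℂ M, (∀ x : Vir, ∀ v ∈ N, ⁅x, v⁆ ∈ N) → N = ⊥ ∨ N = ⊤) :
    LieModule.IsIrreducible ℂ Vir M := by
  refine LieModule.IsIrreducible.mk fun N hN => ?_
  rcases h N.toSubmodule fun x v hv => N.lie_mem hv with hb | ht
  · exact absurd ((LieSubmodule.toSubmodule_eq_bot N).1 hb) hN
  · exact (LieSubmodule.toSubmodule_eq_top N).1 ht

theorem exists_vir_of_z_eq_zero {V : Type*} [AddCommGroup V] [Module ℂ V] {A : SuperAction S V}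
    (hmod : A.IsModule) (hsimple : A.IsSimple) (hhw : A.IsHighestWeight)
    (hF : ∀ x ∈ fermion, ∀ v : V, A.act x v = 0) :
    ∃ (_ : LieRingModule Vir V) (_ : LieModule ℂ Vir V),
      (∀ (x : Vir) (v : V), ⁅x, v⁆ = A.act (virIncl x) v) ∧
        LieModule.IsIrreducible ℂ Vir V ∧ VirIsHighestWeight V := by
  obtain ⟨i1, i2, hact⟩ := exists_lieModule_of_lie (A.act ∘ₗ virIncl) hmod.act_virIncl_lie
  have := hsimple.1
  refine ⟨i1, i2, hact, isIrreducible_of_submodule fun N hN => ?_, ?_⟩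
  · refine SuperAction.eq_bot_or_eq_top_of_virStable hmod hsimple hF fun x v hv => ?_
    exact hact x v ▸ hN x v hv
  · have : virAct V (Vir.e (.L 0)) = A.act (S.e (.L 0)) := by
      ext v
      change ⁅Vir.e (.L 0), v⁆ = _
      rw [hact, LinearMap.comp_apply, virIncl_e]
      rfl
    rw [VirIsHighestWeight, this]
    exact hhw

/-! ### The Clifford algebra of the creation operators -/

/-- The bilinear form `(m, m') ↦ m₀ m'₀`. -/
def zeroModeForm : LinearMap.BilinForm ℂ (ℕ →₀ ℂ) :=
  LinearMap.BilinForm.linMulLin (Finsupp.lapply 0) (Finsupp.lapply 0)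

/-- The quadratic form `m ↦ m₀²`. -/
def zeroModeQuadratic : QuadraticForm ℂ (ℕ →₀ ℂ) := zeroModeForm.toQuadraticMap

theorem zeroModeForm_toQuadraticMap : zeroModeForm.toQuadraticMap = zeroModeQuadratic - 0 :=
  QuadraticMap.ext fun m => (sub_zero (zeroModeQuadratic m)).symm

/-- The linear isomorphism from the Fock space to the Clifford algebra by which the operators
`ξₙ` (`n > 0`) and `ξ₀ + ∂/∂ξ₀` become left multiplications by generators. -/
def fockToClifford : Fock →ₗ[ℂ] CliffordAlgebra zeroModeQuadratic :=
  CliffordAlgebra.changeForm zeroModeForm_toQuadraticMap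

theorem fockToClifford_one : fockToClifford 1 = 1 := CliffordAlgebra.changeForm_one _

/-- Changing the form from 0 to m₀² corrects multiplication by a generator by a contraction, which
is ∂/∂ξ₀ for n = 0 and vanishes for n > 0. -/
theorem fockToClifford_xiMul (n : ℕ) (x : Fock) : fockToClifford (xiMul n x)
    = CliffordAlgebra.ι zeroModeQuadratic (Finsupp.single n 1) * fockToClifford x
      - if n = 0 then fockToClifford (dxi 0 x) else 0 := by
  refine (CliffordAlgebra.changeForm_ι_mul zeroModeForm_toQuadraticMap _ x).trans ?_
  congr 1
  split_ifs with h
  · have : zeroModeForm (Finsupp.single n 1) = Finsupp.lapply 0 := by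
      ext
      simp [zeroModeForm, h]
    rw [this]
    exact (CliffordAlgebra.changeForm_contractLeft zeroModeForm_toQuadraticMap _ x).symm
  · have : zeroModeForm (Finsupp.single n 1) = 0 := by
      ext
      simp [zeroModeForm, Finsupp.single_eq_of_ne (Ne.symm h)]
    rw [this, map_zero, LinearMap.zero_apply]

/-- `V` is an `S`-module on which `z` acts by `r²`, where `r ≠ 0`. -/
structure SuperAction.HasLevel {V : Type*} [AddCommGroup V] [Module ℂ V] (A : SuperAction S V)
    (r : ℂ) : Prop where
  isModule : A.IsModule
  ne_zero : r ≠ 0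
  act_z : ∀ v, A.act (S.e .z) v = r ^ 2 • v

namespace SuperAction

variable {V : Type*} [AddCommGroup V] [Module ℂ V] {A : SuperAction S V} {r : ℂ}

/-- The even vectors killed by all `ψₙ`, `n > 0`. -/
def evenVacuum (A : SuperAction S V) : Submodule ℂ V :=
  A.grading.part 0 ⊓ ⨅ n : ℕ, (A.act (S.e (.psi (n + 1 : ℕ)))).ker

theorem mem_evenVacuum {v : V} : v ∈ A.evenVacuum ↔
    v ∈ A.grading.part 0 ∧ ∀ n : ℕ, A.act (S.e (.psi (n + 1 : ℕ))) v = 0 := by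
  simp only [evenVacuum, Submodule.mem_inf, Submodule.mem_iInf, LinearMap.mem_ker]

/-- The operators by which the generators of the Clifford algebra act. -/
def creation (A : SuperAction S V) (r : ℂ) : (ℕ →₀ ℂ) →ₗ[ℂ] Module.End ℂ V :=
  Finsupp.linearCombination ℂ fun n =>
    ((if n = 0 then (Real.sqrt 2 : ℂ) else 1) * r⁻¹) • A.act (S.e (.psi (-(n : ℤ))))

theorem creation_single (n : ℕ) : A.creation r (Finsupp.single n 1)
    = ((if n = 0 then (Real.sqrt 2 : ℂ) else 1) * r⁻¹) • A.act (S.e (.psi (-(n : ℤ)))) := by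
  simp [creation]

namespace HasLevel

theorem psi_psi (h : A.HasLevel r) (m n : ℤ) (v : V) :
    A.act (S.e (.psi m)) (A.act (S.e (.psi n)) v) + A.act (S.e (.psi n)) (A.act (S.e (.psi m)) v)
      = if m + n = 0 then r ^ 2 • v else 0 := by
  rw [h.isModule.psi_psi, h.act_z]

/-- Two nonpositive modes have a nonzero anticommutator only if both are 0. The factor √2 r⁻¹ on ψ₀
turns 2ψ₀² = r² into a square equal to 1, the value of the form on the zeroth basis vector. -/
theorem creation_add_creation (h : A.HasLevel r) (m m' : ℕ →₀ ℂ) :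
    A.creation r m * A.creation r m' + A.creation r m' * A.creation r m
      = algebraMap ℂ (Module.End ℂ V) (2 * zeroModeForm m m') := by
  have key : (LinearMap.mul ℂ (Module.End ℂ V)).compl₁₂ (A.creation r) (A.creation r)
      + ((LinearMap.mul ℂ (Module.End ℂ V)).compl₁₂ (A.creation r) (A.creation r)).flip
      = (2 : ℂ) • zeroModeForm.compr₂ (Algebra.linearMap ℂ (Module.End ℂ V)) := by
    refine Finsupp.lhom_ext' fun n => LinearMap.ext_ring (Finsupp.lhom_ext' fun k =>
      LinearMap.ext_ring (LinearMap.ext fun v => ?_))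
    have hnk := h.psi_psi (-(n : ℤ)) (-(k : ℤ)) v
    simp only [LinearMap.comp_apply, Finsupp.lsingle_apply, LinearMap.add_apply,
      LinearMap.compl₁₂_apply, LinearMap.mul_apply', LinearMap.flip_apply, Module.End.mul_apply,
      LinearMap.smul_apply, LinearMap.compr₂_apply, Algebra.linearMap_apply, creation_single,
      map_smul, Module.algebraMap_end_apply]
    rw [smul_smul, smul_smul, mul_comm (_ * r⁻¹), ← smul_add, hnk]
    by_cases hn : n = 0
    · by_cases hk : k = 0
      · subst hn hk
        simp only [if_true, zeroModeForm, LinearMap.BilinForm.linMulLin_apply,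
          Finsupp.lapply_apply, Finsupp.single_eq_same]
        rw [if_pos (by simp), smul_smul, smul_smul]
        congr 1
        have h2 := sqrt_two_mul_self
        have hr := h.ne_zero
        field_simp
        linear_combination h2
      · rw [if_neg (show ¬(-(n : ℤ) + -(k : ℤ) = 0) by omega)]
        simp [zeroModeForm, Finsupp.single_eq_of_ne (Ne.symm hk)]
    · rw [if_neg (show ¬(-(n : ℤ) + -(k : ℤ) = 0) by omega)]
      simp [zeroModeForm, Finsupp.single_eq_of_ne (Ne.symm hn)]
  have := LinearMap.congr_fun₂ key m m'
  simp only [LinearMap.add_apply, LinearMap.compl₁₂_apply, LinearMap.mul_apply',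
    LinearMap.flip_apply, LinearMap.smul_apply, LinearMap.compr₂_apply,
    Algebra.linearMap_apply] at this
  rw [this, map_mul, Algebra.smul_def]

theorem creation_mul_self (h : A.HasLevel r) (m : ℕ →₀ ℂ) :
    A.creation r m * A.creation r m
      = algebraMap ℂ (Module.End ℂ V) (zeroModeQuadratic m) := by
  have := h.creation_add_creation m m
  rw [map_mul, ← two_mul, map_ofNat] at this
  have h2 : (2 : ℂ) • (A.creation r m * A.creation r m)
      = (2 : ℂ) • algebraMap ℂ (Module.End ℂ V) (zeroModeForm m m) := by
    rw [two_smul, two_smul, ← two_mul, ← two_mul, this]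
  exact smul_right_injective _ two_ne_zero h2

/-- The action on `V` of the polynomials in the creation operators. -/
def fockMap (h : A.HasLevel r) : Fock →ₗ[ℂ] Module.End ℂ V :=
  (CliffordAlgebra.lift zeroModeQuadratic ⟨A.creation r, h.creation_mul_self⟩).toLinearMap ∘ₗ
    fockToClifford

theorem fockMap_one (h : A.HasLevel r) (v : V) : h.fockMap 1 v = v := by
  simp [fockMap, fockToClifford_one]

theorem fockMap_xiMul (h : A.HasLevel r) (n : ℕ) (x : Fock) (v : V) :
    h.fockMap (xiMul n x) v = A.creation r (Finsupp.single n 1) (h.fockMap x v)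
      - if n = 0 then h.fockMap (dxi 0 x) v else 0 := by
  simp only [fockMap, LinearMap.comp_apply, fockToClifford_xiMul, map_sub, AlgHom.toLinearMap_apply,
    map_mul, CliffordAlgebra.lift_ι_apply, LinearMap.sub_apply, Module.End.mul_apply]
  split_ifs <;> simp

theorem fockMap_psi_of_nonpos (h : A.HasLevel r) {n : ℤ} (hn : n ≤ 0) (x : Fock) (v : V) :
    r • h.fockMap (fockPsi n x) v = A.act (S.e (.psi n)) (h.fockMap x v) := by
  rcases int_cases n with rfl | ⟨k, rfl⟩ | ⟨k, rfl⟩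
  · rw [fockPsi_zero, LinearMap.smul_apply, LinearMap.add_apply, map_smul, map_add,
      LinearMap.smul_apply, LinearMap.add_apply, fockMap_xiMul, if_pos rfl, sub_add_cancel,
      creation_single, if_pos rfl, LinearMap.smul_apply, smul_smul, smul_smul]
    have : r * (1 / (Real.sqrt 2 : ℂ)) * ((Real.sqrt 2 : ℂ) * r⁻¹) = 1 := by
      have := sqrt_two_ne_zero
      have := h.ne_zero
      field_simp
    rw [this, one_smul]
    rfl
  · omega
  · rw [fockPsi_neg, fockMap_xiMul, if_neg (by omega), sub_zero, creation_single,
      if_neg (by omega), LinearMap.smul_apply, smul_smul, one_mul, mul_inv_cancel₀ h.ne_zero,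
      one_smul]

theorem smul_cancel (h : A.HasLevel r) {v w : V} (e : r • v = r • w) : v = w :=
  smul_right_injective _ h.ne_zero e

/-- Nonpositive modes are the Clifford generators and need no condition on v. For n > 0 the two
sides agree at x = 1 because v is a vacuum vector, and the equal anticommutators carry this through
the nonpositive modes, which generate the Fock space. -/
theorem fockMap_psi (h : A.HasLevel r) (n : ℤ) (x : Fock) {v : V} (hv : v ∈ A.evenVacuum) :
    r • h.fockMap (fockPsi n x) v = A.act (S.e (.psi n)) (h.fockMap x v) := by
  rcases le_or_gt n 0 with hn | hn
  · exact h.fockMap_psi_of_nonpos hn x v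
  have htop : LinearMap.eqLocus (r • (h.fockMap.flip v ∘ₗ fockPsi n))
      (A.act (S.e (.psi n)) ∘ₗ h.fockMap.flip v) = ⊤ := by
    refine fock_eq_top ?_ fun k hk x hx => ?_
    · have h0 := (mem_evenVacuum.1 hv).2 (n.toNat - 1)
      rw [show (((n.toNat - 1 + 1 : ℕ)) : ℤ) = n by omega] at h0
      simp [LinearMap.mem_eqLocus, fockPsi_one_of_pos hn, fockMap_one, h0]
    · simp only [LinearMap.mem_eqLocus, LinearMap.smul_apply, LinearMap.comp_apply,
        LinearMap.flip_apply] at hx ⊢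
      refine h.smul_cancel ?_
      rw [← map_smul (A.act _), h.fockMap_psi_of_nonpos hk,
        eq_sub_of_add_eq (fockPsi_fockPsi n k x), eq_sub_of_add_eq (h.psi_psi n k _), ← hx,
        map_smul, ← h.fockMap_psi_of_nonpos hk, map_sub, LinearMap.sub_apply, smul_sub, smul_sub]
      congr 1
      split_ifs
      · rw [smul_smul, sq]
      · simp
  have hx : x ∈ LinearMap.eqLocus (r • (h.fockMap.flip v ∘ₗ fockPsi n))
      (A.act (S.e (.psi n)) ∘ₗ h.fockMap.flip v) := htop ▸ Submodule.mem_top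
  exact hx

theorem parityOp_fockMap (h : A.HasLevel r) (x : Fock) {v : V} (hv : v ∈ A.evenVacuum) :
    A.grading.parityOp (h.fockMap x v) = h.fockMap (fockAction.grading.parityOp x) v := by
  have htop : LinearMap.eqLocus (A.grading.parityOp ∘ₗ h.fockMap.flip v)
      (h.fockMap.flip v ∘ₗ fockAction.grading.parityOp) = ⊤ := by
    refine fock_eq_top ?_ fun k hk x hx => ?_
    · simp [LinearMap.mem_eqLocus, fock_parityOp, fockMap_one,
        A.grading.parityOp_even (mem_evenVacuum.1 hv).1]
    · simp only [LinearMap.mem_eqLocus, LinearMap.comp_apply, LinearMap.flip_apply] at hx ⊢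
      refine h.smul_cancel ?_
      rw [← map_smul, h.fockMap_psi_of_nonpos hk, h.isModule.parityOp_psi, hx,
        fock_parityOp_fockPsi, map_neg, LinearMap.neg_apply, smul_neg, h.fockMap_psi_of_nonpos hk]
  have hx : x ∈ LinearMap.eqLocus (A.grading.parityOp ∘ₗ h.fockMap.flip v)
      (h.fockMap.flip v ∘ₗ fockAction.grading.parityOp) := htop ▸ Submodule.mem_top
  exact hx

/-- Makes an operator commuting with the fermions act only on the second factor of the tensor
decomposition. -/
theorem map_fockMap (h : A.HasLevel r) {T : Module.End ℂ V}
    (hT : ∀ n v, T (A.act (S.e (.psi n)) v) = A.act (S.e (.psi n)) (T v)) (x : Fock) (v : V) :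
    T (h.fockMap x v) = h.fockMap x (T v) := by
  have htop : LinearMap.eqLocus (T ∘ₗ h.fockMap.flip v) (h.fockMap.flip (T v)) = ⊤ := by
    refine fock_eq_top ?_ fun k hk x hx => ?_
    · simp [LinearMap.mem_eqLocus, fockMap_one]
    · simp only [LinearMap.mem_eqLocus, LinearMap.comp_apply, LinearMap.flip_apply] at hx ⊢
      refine h.smul_cancel ?_
      rw [← map_smul, h.fockMap_psi_of_nonpos hk, hT, hx, h.fockMap_psi_of_nonpos hk]
  have hx : x ∈ LinearMap.eqLocus (T ∘ₗ h.fockMap.flip v) (h.fockMap.flip (T v)) :=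
    htop ▸ Submodule.mem_top
  exact hx

/-! ### The decomposition of a module of nonzero level -/

/-- The map from the tensor product of the Fock space with the even vacuum vectors. -/
def tensorMap (h : A.HasLevel r) : Fock ⊗[ℂ] A.evenVacuum →ₗ[ℂ] V :=
  TensorProduct.lift (LinearMap.lcomp ℂ V A.evenVacuum.subtype ∘ₗ h.fockMap)

theorem tensorMap_tmul (h : A.HasLevel r) (x : Fock) (v : A.evenVacuum) :
    h.tensorMap (x ⊗ₜ v) = h.fockMap x v := rfl

theorem tensorMap_psi (h : A.HasLevel r) (n : ℤ) (t : Fock ⊗[ℂ] A.evenVacuum) :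
    r • h.tensorMap ((fockPsi n).rTensor _ t) = A.act (S.e (.psi n)) (h.tensorMap t) := by
  induction t using TensorProduct.induction_on with
  | zero => simp
  | add x y hx hy => simp only [map_add, smul_add, hx, hy]
  | tmul x v => exact h.fockMap_psi n x v.2

theorem parityOp_tensorMap (h : A.HasLevel r) (t : Fock ⊗[ℂ] A.evenVacuum) :
    A.grading.parityOp (h.tensorMap t)
      = h.tensorMap (fockAction.grading.parityOp.rTensor _ t) := by
  induction t using TensorProduct.induction_on with
  | zero => simp
  | add x y hx hy => simp only [map_add, hx, hy]
  | tmul x v => exact h.parityOp_fockMap x v.2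

theorem psi_zero_injective (h : A.HasLevel r) {v : V} (hv : A.act (S.e (.psi 0)) v = 0) :
    v = 0 := by
  have h0 := h.psi_psi 0 0 v
  rw [hv, map_zero, add_zero, if_pos (add_zero 0), eq_comm] at h0
  exact (smul_eq_zero.1 h0).resolve_left (pow_ne_zero 2 h.ne_zero)

theorem fockMap_xi_zero (h : A.HasLevel r) (v : V) :
    h.fockMap (xi 0) v = ((Real.sqrt 2 : ℂ) * r⁻¹) • A.act (S.e (.psi 0)) v := by
  have := h.fockMap_xiMul 0 1 v
  rwa [xiMul_apply, mul_one, fockMap_one, dxi_one, if_pos rfl, map_zero, LinearMap.zero_apply,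
    sub_zero, creation_single, if_pos rfl] at this

/-- The argument of `eq_of_vacuum` with coefficients in M; it carries over because
`eq_zero_of_vacuum` uses only the anticommutation relations. -/
theorem tensor_eq_of_vacuum {M : Type*} [AddCommGroup M] [Module ℂ M] {t : Fock ⊗[ℂ] M}
    (ht : ∀ n, (dxi (n + 1)).rTensor M t = 0) : ∃ m m' : M, t = 1 ⊗ₜ m + xi 0 ⊗ₜ m' := by
  have hdec : ∃ (m m' : M) (y : Fock ⊗[ℂ] M), y ∈ ⨆ n, ((xiMul (n + 1)).rTensor M).range ∧
      t = 1 ⊗ₜ m + xi 0 ⊗ₜ m' + y := by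
    clear ht
    induction t using TensorProduct.induction_on with
    | zero => exact ⟨0, 0, 0, Submodule.zero_mem _, by simp⟩
    | add t t' ht ht' =>
      obtain ⟨m, n, y, hy, rfl⟩ := ht
      obtain ⟨m', n', y', hy', rfl⟩ := ht'
      exact ⟨m + m', n + n', y + y', Submodule.add_mem _ hy hy', by
        rw [TensorProduct.tmul_add, TensorProduct.tmul_add]; abel⟩
    | tmul x m =>
      obtain ⟨a, b, y, hy, rfl⟩ := exists_vacuum_add x
      refine ⟨a • m, b • m, y ⊗ₜ m, ?_, by
        rw [TensorProduct.add_tmul, TensorProduct.add_tmul, TensorProduct.smul_tmul,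
          TensorProduct.smul_tmul]⟩
      have hle : ⨆ n, (xiMul (n + 1)).range ≤
          (⨆ n, ((xiMul (n + 1)).rTensor M).range).comap ((TensorProduct.mk ℂ Fock M).flip m) := by
        refine iSup_le fun n => ?_
        rintro _ ⟨w, rfl⟩
        exact Submodule.mem_iSup_of_mem n ⟨w ⊗ₜ m, rfl⟩
      exact hle hy
  obtain ⟨m, m', y, hy, rfl⟩ := hdec
  have hvac : ∀ n, (dxi (n + 1)).rTensor M ((1 : Fock) ⊗ₜ m + xi 0 ⊗ₜ m') = 0 := fun n => by
    have h0 := dxi_xiMul (n + 1) 0 1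
    rw [dxi_one, map_zero, add_zero, if_neg (by omega), xiMul_apply, mul_one] at h0
    simp [dxi_one, h0]
  have hy0 : y = 0 := by
    refine eq_zero_of_vacuum (a := fun n => (dxi (n + 1)).rTensor M)
      (c := fun n => (xiMul (n + 1)).rTensor M) ?_ ?_ hy fun n => ?_
    · intro k n t
      induction t using TensorProduct.induction_on with
      | zero => simp
      | add t t' ht ht' =>
        simp only [map_add]
        rw [add_add_add_comm, ht, ht']
        split_ifs <;> simp
      | tmul x m =>
        simp only [LinearMap.rTensor_tmul]
        rw [← TensorProduct.add_tmul, dxi_xiMul]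
        split_ifs <;> first | rfl | omega | simp
    · intro k n t
      induction t using TensorProduct.induction_on with
      | zero => simp
      | add t t' ht ht' =>
        simp only [map_add]
        rw [add_add_add_comm, ht, ht', add_zero]
      | tmul x m =>
        simp only [LinearMap.rTensor_tmul]
        rw [← TensorProduct.add_tmul, xiMul_xiMul, TensorProduct.zero_tmul]
    · have := ht n
      rwa [map_add, hvac, zero_add] at this
  exact ⟨m, m', by rw [hy0, add_zero]⟩

/-- The kernel is stable under all annihilation and creation operators, so by `le_of_vacuum_le` with
target ⊥ it suffices that it contains no nonzero vacuum vector. -/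
theorem tensorMap_injective (h : A.HasLevel r) : Function.Injective h.tensorMap := by
  refine LinearMap.ker_eq_bot.1 (le_bot_iff.1 (le_of_vacuum_le
    (a := fun n => (dxi (n + 1)).rTensor A.evenVacuum)
    (c := fun n => (xiMul (n + 1)).rTensor A.evenVacuum) ?_ ?_ ?_ ?_ ?_ ?_ ?_))
  · intro k n t
    induction t using TensorProduct.induction_on with
    | zero => simp
    | add t t' ht ht' =>
      simp only [map_add]
      rw [add_add_add_comm, ht, ht']
      split_ifs <;> simp
    | tmul x m =>
      simp only [LinearMap.rTensor_tmul]
      rw [← TensorProduct.add_tmul, dxi_xiMul]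
      split_ifs <;> first | rfl | omega | simp
  · intro k n t
    induction t using TensorProduct.induction_on with
    | zero => simp
    | add t t' ht ht' =>
      simp only [map_add]
      rw [add_add_add_comm, ht, ht', add_zero]
    | tmul x m =>
      simp only [LinearMap.rTensor_tmul]
      rw [← TensorProduct.add_tmul, dxi_dxi, TensorProduct.zero_tmul]
  · intro n t ht
    rw [LinearMap.mem_ker] at ht ⊢
    refine h.smul_cancel ?_
    rw [← fockPsi_pos, h.tensorMap_psi, ht, map_zero, smul_zero]
  · intro n t ht
    rw [LinearMap.mem_ker] at ht ⊢
    refine h.smul_cancel ?_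
    rw [← fockPsi_neg, h.tensorMap_psi, ht, map_zero, smul_zero]
  · intro n t ht
    rw [(Submodule.mem_bot _).1 ht, map_zero]
    exact Submodule.zero_mem _
  · intro t ht hvac
    obtain ⟨m, m', rfl⟩ := tensor_eq_of_vacuum hvac
    rw [LinearMap.mem_ker, map_add, tensorMap_tmul, tensorMap_tmul, fockMap_one,
      fockMap_xi_zero] at ht
    -- The image is m plus a nonzero multiple of ψ₀ m'. The first is even and the second odd, so
    -- both vanish, and ψ₀ is injective.
    have hm := (mem_evenVacuum.1 m.2).1
    have hm' := h.isModule.basis_mem (.psi 0) (mem_evenVacuum.1 m'.2).1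
    have hodd : (m : V) ∈ A.grading.part 1 := by
      rw [eq_neg_of_add_eq_zero_left ht]
      exact Submodule.neg_mem _ (Submodule.smul_mem _ _ hm')
    have hm0 : (m : V) = 0 := Submodule.disjoint_def.1 A.grading.isCompl.disjoint _ hm hodd
    rw [hm0, zero_add, smul_eq_zero] at ht
    have hm0' := h.psi_zero_injective
      (ht.resolve_left (mul_ne_zero sqrt_two_ne_zero (inv_ne_zero h.ne_zero)))
    rw [Submodule.coe_eq_zero] at hm0 hm0'
    simp [hm0, hm0']
  · intro t ht
    clear ht
    induction t using TensorProduct.induction_on with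
    | zero => exact ⟨0, by simp⟩
    | add t t' ht ht' =>
      obtain ⟨N, hN⟩ := ht
      obtain ⟨K, hK⟩ := ht'
      exact ⟨max N K, fun n hn => by
        rw [map_add, hN n (le_of_max_le_left hn), hK n (le_of_max_le_right hn), add_zero]⟩
    | tmul x m =>
      obtain ⟨N, hN⟩ := exists_dxi_eq_zero x
      exact ⟨N, fun n hn => by
        rw [LinearMap.rTensor_tmul, hN _ (by omega), TensorProduct.zero_tmul]⟩

/-- The range is stable under all ψₙ, so by `le_of_vacuum_le` only vacuum vectors have to be
reached. -/
theorem tensorMap_surjective (h : A.HasLevel r) (hhw : A.IsHighestWeight) :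
    Function.Surjective h.tensorMap := by
  have hr := h.ne_zero
  have hψ : ∀ n, ∀ v ∈ h.tensorMap.range, A.act (S.e (.psi n)) v ∈ h.tensorMap.range := by
    rintro n _ ⟨t, rfl⟩
    rw [← h.tensorMap_psi]
    exact Submodule.smul_mem _ _ ⟨_, rfl⟩
  have hr2 : r⁻¹ * r⁻¹ * r ^ 2 = 1 := by field_simp
  refine LinearMap.range_eq_top.1 (top_le_iff.1 (le_of_vacuum_le
    (a := fun n => r⁻¹ • A.act (S.e (.psi (n + 1 : ℕ))))
    (c := fun n => r⁻¹ • A.act (S.e (.psi (-(n + 1 : ℕ))))) ?_ ?_ ?_ ?_ ?_ ?_ ?_))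
  · intro m n v
    simp only [LinearMap.smul_apply, map_smul]
    rw [← smul_add, ← smul_add, h.psi_psi, smul_smul]
    by_cases hmn : m = n
    · rw [if_pos hmn, if_pos (by omega), smul_smul, hr2, one_smul]
    · rw [if_neg hmn, if_neg (by omega), smul_zero]
  · intro m n v
    simp only [LinearMap.smul_apply, map_smul]
    rw [← smul_add, ← smul_add, h.psi_psi, if_neg (by omega), smul_zero, smul_zero]
  · exact fun _ _ _ => Submodule.mem_top
  · exact fun _ _ _ => Submodule.mem_top
  · exact fun n v hv => Submodule.smul_mem _ _ (hψ _ v hv)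
  · intro v _ hv
    have hv' : ∀ n : ℕ, A.act (S.e (.psi (n + 1 : ℕ))) v = 0 := fun n =>
      (smul_eq_zero.1 (hv n)).resolve_left (inv_ne_zero hr)
    have hP : ∀ n : ℕ, A.act (S.e (.psi (n + 1 : ℕ))) (A.grading.parityOp v) = 0 := fun n => by
      rw [← neg_eq_zero, ← h.isModule.parityOp_psi, hv', map_zero]
    have he : ∀ n : ℕ, A.act (S.e (.psi (n + 1 : ℕ))) (A.grading.evenProj v) = 0 := fun n => by
      have := congrArg (A.act (S.e (.psi (n + 1 : ℕ)))) (A.grading.add_parityOp v)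
      rw [map_add, hv', hP, add_zero, map_smul, eq_comm, smul_eq_zero] at this
      exact this.resolve_left two_ne_zero
    have ho : ∀ n : ℕ, A.act (S.e (.psi (n + 1 : ℕ))) (A.grading.oddProj v) = 0 := fun n => by
      have := congrArg (A.act (S.e (.psi (n + 1 : ℕ)))) (A.grading.evenProj_add_oddProj v)
      rwa [map_add, hv', he, zero_add] at this
    have hmem : ∀ w ∈ A.evenVacuum, w ∈ h.tensorMap.range := fun w hw =>
      ⟨1 ⊗ₜ ⟨w, hw⟩, by rw [tensorMap_tmul, fockMap_one]⟩
    rw [← A.grading.evenProj_add_oddProj v]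
    refine Submodule.add_mem _ (hmem _ (mem_evenVacuum.2 ⟨A.grading.evenProj_mem v, he⟩)) ?_
    -- The odd part o is recovered from r² o = 2ψ₀(ψ₀ o), where ψ₀ o is an even vacuum vector.
    have h00 := h.psi_psi 0 0 (A.grading.oddProj v)
    rw [if_pos (add_zero 0)] at h00
    have h1 : A.act (S.e (.psi 0)) (A.grading.oddProj v) ∈ A.evenVacuum := by
      refine mem_evenVacuum.2
        ⟨h.isModule.basis_mem (.psi 0) (A.grading.oddProj_mem v), fun n => ?_⟩
      have := h.psi_psi (n + 1 : ℕ) 0 (A.grading.oddProj v)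
      rwa [ho, map_zero, add_zero, if_neg (by omega)] at this
    have h2 := hψ 0 _ (hmem _ h1)
    have h3 := Submodule.smul_mem _ (r ^ 2)⁻¹ (Submodule.add_mem _ h2 h2)
    rwa [h00, inv_smul_smul₀ (pow_ne_zero 2 hr)] at h3
  · intro v _
    obtain ⟨N, hN⟩ := exists_psi_eq_zero h.isModule hhw v
    exact ⟨N, fun n hn => by rw [LinearMap.smul_apply, hN _ (by omega), smul_zero]⟩

/-- A highest weight module of nonzero level is the tensor product of the Fock space with its even
vacuum vectors, as a vector space. -/
def tensorEquiv (h : A.HasLevel r) (hhw : A.IsHighestWeight) : Fock ⊗[ℂ] A.evenVacuum ≃ₗ[ℂ] V :=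
  LinearEquiv.ofBijective h.tensorMap ⟨h.tensorMap_injective, h.tensorMap_surjective hhw⟩

theorem tensorEquiv_apply (h : A.HasLevel r) (hhw : A.IsHighestWeight)
    (t : Fock ⊗[ℂ] A.evenVacuum) : h.tensorEquiv hhw t = h.tensorMap t := rfl

theorem tensorMap_symm_apply (h : A.HasLevel r) (hhw : A.IsHighestWeight) (v : V) :
    h.tensorMap ((h.tensorEquiv hhw).symm v) = v := (h.tensorEquiv hhw).apply_symm_apply v

theorem symm_tensorMap (h : A.HasLevel r) (hhw : A.IsHighestWeight)
    (t : Fock ⊗[ℂ] A.evenVacuum) : (h.tensorEquiv hhw).symm (h.tensorMap t) = t :=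
  (h.tensorEquiv hhw).symm_apply_apply t

/-! ### The commuting action of the Virasoro algebra -/

/-- Having this on all of F makes it apply to [x, ψₙ] without computing that bracket. -/
theorem act_fermion (h : A.HasLevel r) {y : S} (hy : y ∈ fermion)
    (t : Fock ⊗[ℂ] A.evenVacuum) :
    h.tensorMap (((fockAction.twist (sigma r)).act y).rTensor _ t) = A.act y (h.tensorMap t) := by
  have hle : fermion ≤ LinearMap.eqLocus
      (h.tensorMap ∘ₗ LinearMap.applyₗ t ∘ₗ LinearMap.rTensorHom A.evenVacuum ∘ₗ
        (fockAction.twist (sigma r)).act) (A.act.flip (h.tensorMap t)) := by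
    refine Submodule.span_le.2 ?_
    rintro _ (⟨n, rfl⟩ | rfl)
    · change h.tensorMap (((fockAction.twist (sigma r)).act (S.e (.psi n))).rTensor _ t) =
        A.act (S.e (.psi n)) (h.tensorMap t)
      rw [fock_act_psi, LinearMap.rTensor_smul, LinearMap.smul_apply, map_smul, h.tensorMap_psi]
    · change h.tensorMap (((fockAction.twist (sigma r)).act (S.e .z)).rTensor _ t) =
        A.act (S.e .z) (h.tensorMap t)
      rw [fock_act_z, LinearMap.rTensor_smul, LinearMap.smul_apply, map_smul, h.act_z,
        LinearMap.rTensor_id, LinearMap.id_apply]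
  exact hle hy

end HasLevel

theorem bracket_psi_mem_fermion (x : S) (n : ℤ) : S.bracket x (S.e (.psi n)) ∈ fermion := by
  refine S.mem_of_basis (f := S.bracket.flip (S.e (.psi n))) (fun a => ?_) x
  rw [LinearMap.flip_apply, S.bracket_e]
  cases a
  · exact Submodule.smul_mem _ _ (Submodule.subset_span (Or.inl ⟨_, rfl⟩))
  · exact Submodule.smul_mem _ _ (Submodule.subset_span (Or.inr rfl))
  all_goals exact Submodule.zero_mem _

variable {V : Type*} [AddCommGroup V] [Module ℂ V] {A : SuperAction S V} {r : ℂ}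

theorem IsModule.virIncl_psi (h : A.IsModule) (x : Vir) (n : ℤ) (v : V) :
    A.act (virIncl x) (A.act (S.e (.psi n)) v) = A.act (S.e (.psi n)) (A.act (virIncl x) v)
      + A.act (S.bracket (virIncl x) (S.e (.psi n))) v := by
  have := h.act_bracket (virIncl_parity x) (S.e_mem (.psi n)) v
  rw [koszul_zero_left, one_smul] at this
  change A.act (S.bracket _ _) v = _ at this
  rw [this]
  abel

theorem IsModule.parityOp_virIncl (h : A.IsModule) (x : Vir) (v : V) :
    A.grading.parityOp (A.act (virIncl x) v) = A.act (virIncl x) (A.grading.parityOp v) :=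
  A.grading.parityOp_map A.grading (fun i w hw => by
    have := h.act_mem (virIncl_parity x) hw
    rwa [zero_add] at this) v

namespace HasLevel

/-- The difference between the action of `Vir` on `V` and its action on the Fock space factor. -/
def virShift (h : A.HasLevel r) (hhw : A.IsHighestWeight) : Vir →ₗ[ℂ] Module.End ℂ V :=
  A.act ∘ₗ virIncl - (h.tensorEquiv hhw).conj.toLinearMap ∘ₗ
    LinearMap.rTensorHom A.evenVacuum ∘ₗ (fockAction.twist (sigma r)).act ∘ₗ virIncl

theorem virShift_tensorMap (h : A.HasLevel r) (hhw : A.IsHighestWeight) (x : Vir)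
    (t : Fock ⊗[ℂ] A.evenVacuum) : h.virShift hhw x (h.tensorMap t)
      = A.act (virIncl x) (h.tensorMap t)
        - h.tensorMap (((fockAction.twist (sigma r)).act (virIncl x)).rTensor _ t) := by
  have : h.virShift hhw x (h.tensorMap t) = A.act (virIncl x) (h.tensorMap t)
      - h.tensorMap (((fockAction.twist (sigma r)).act (virIncl x)).rTensor _
        ((h.tensorEquiv hhw).symm (h.tensorMap t))) := rfl
  rw [this, symm_tensorMap]

/-- In both actions the commutator of x with ψₙ is the action of [x, ψₙ] ∈ F, and F acts on V
through the Fock factor. The commutators cancel in the difference. -/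
theorem virShift_psi (h : A.HasLevel r) (hhw : A.IsHighestWeight) (x : Vir) (n : ℤ) (v : V) :
    h.virShift hhw x (A.act (S.e (.psi n)) v) = A.act (S.e (.psi n)) (h.virShift hhw x v) := by
  obtain ⟨t, rfl⟩ := h.tensorMap_surjective hhw v
  have hψ : S.e (.psi n) ∈ fermion := Submodule.subset_span (Or.inl ⟨n, rfl⟩)
  have hB : ((fockAction.twist (sigma r)).act (virIncl x)) ∘ₗ
      ((fockAction.twist (sigma r)).act (S.e (.psi n)))
      = ((fockAction.twist (sigma r)).act (S.e (.psi n))) ∘ₗ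
      ((fockAction.twist (sigma r)).act (virIncl x))
      + (fockAction.twist (sigma r)).act (S.bracket (virIncl x) (S.e (.psi n))) :=
    LinearMap.ext fun y => (fock_isModule r).virIncl_psi x n y
  rw [← h.act_fermion hψ, virShift_tensorMap, virShift_tensorMap, h.act_fermion hψ,
    h.isModule.virIncl_psi, map_sub, ← h.act_fermion hψ, ← LinearMap.rTensor_comp_apply,
    ← LinearMap.rTensor_comp_apply, hB, LinearMap.rTensor_add, LinearMap.add_apply, map_add,
    h.act_fermion (bracket_psi_mem_fermion _ n)]
  abel

theorem virShift_mem (h : A.HasLevel r) (hhw : A.IsHighestWeight) (x : Vir) {v : V}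
    (hv : v ∈ A.evenVacuum) : h.virShift hhw x v ∈ A.evenVacuum := by
  refine mem_evenVacuum.2 ⟨A.grading.parityOp_eq_self_iff.1 ?_, fun n => ?_⟩
  · have hvt : v = h.tensorMap (1 ⊗ₜ ⟨v, hv⟩) := by rw [tensorMap_tmul, fockMap_one]
    have hone : fockAction.grading.parityOp 1 = 1 := by rw [fock_parityOp, map_one]
    have hB := (fock_isModule r).parityOp_virIncl x 1
    change fockAction.grading.parityOp ((fockAction.twist (sigma r)).act (virIncl x) 1)
      = (fockAction.twist (sigma r)).act (virIncl x) (fockAction.grading.parityOp 1) at hB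
    rw [hvt, virShift_tensorMap, map_sub, h.isModule.parityOp_virIncl, parityOp_tensorMap,
      parityOp_tensorMap]
    simp only [LinearMap.rTensor_tmul, hB, hone]
  · rw [← virShift_psi, (mem_evenVacuum.1 hv).2, map_zero]

/-- The action of `Vir` on the even vacuum vectors that commutes with the Fock space factor. -/
def vacuumAct (h : A.HasLevel r) (hhw : A.IsHighestWeight) :
    Vir →ₗ[ℂ] Module.End ℂ A.evenVacuum where
  toFun x := (h.virShift hhw x).restrict fun _ hv => h.virShift_mem hhw x hv
  map_add' x y := by ext v; simp
  map_smul' t x := by ext v; simp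

theorem coe_vacuumAct (h : A.HasLevel r) (hhw : A.IsHighestWeight) (x : Vir) (v : A.evenVacuum) :
    (h.vacuumAct hhw x v : V) = h.virShift hhw x v := rfl

/-- The shifted action commutes with the fermions, so it passes through `fockMap` and acts as the
identity tensored with its restriction to the even vacuum vectors. -/
theorem act_tensorMap (h : A.HasLevel r) (hhw : A.IsHighestWeight) (x : Vir)
    (t : Fock ⊗[ℂ] A.evenVacuum) : A.act (virIncl x) (h.tensorMap t)
      = h.tensorMap (((fockAction.twist (sigma r)).act (virIncl x)).rTensor _ t
        + (h.vacuumAct hhw x).lTensor Fock t) := by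
  have key : h.virShift hhw x (h.tensorMap t)
      = h.tensorMap ((h.vacuumAct hhw x).lTensor Fock t) := by
    induction t using TensorProduct.induction_on with
    | zero => simp
    | add t t' ht ht' => simp only [map_add, ht, ht']
    | tmul y v =>
      rw [LinearMap.lTensor_tmul, tensorMap_tmul, tensorMap_tmul,
        h.map_fockMap (h.virShift_psi hhw x), coe_vacuumAct]
  rw [map_add, ← key, virShift_tensorMap]
  abel

/-- The bracket relations on V and on the Fock space are compared on 1 ⊗ v. Operators on different
factors commute, so only the bracket on the second factor remains; `tensorMap` sends 1 ⊗ w to w, so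
it can be read off. -/
theorem vacuumAct_lie (h : A.HasLevel r) (hhw : A.IsHighestWeight) (x y : Vir) :
    h.vacuumAct hhw ⁅x, y⁆ = ⁅h.vacuumAct hhw x, h.vacuumAct hhw y⁆ := by
  ext1 v
  have h1 := h.act_tensorMap hhw ⁅x, y⁆ (1 ⊗ₜ v)
  rw [h.isModule.act_virIncl_lie, (fock_isModule r).act_virIncl_lie, Ring.lie_def,
    LinearMap.sub_apply, Module.End.mul_apply, Module.End.mul_apply, h.act_tensorMap hhw y,
    h.act_tensorMap hhw x, h.act_tensorMap hhw x, h.act_tensorMap hhw y, ← map_sub] at h1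
  have h2 := h.tensorMap_injective h1
  simp only [LinearMap.rTensor_tmul, LinearMap.lTensor_tmul, map_add, Ring.lie_def,
    LinearMap.sub_apply, Module.End.mul_apply, TensorProduct.sub_tmul] at h2
  have h3 : (1 : Fock) ⊗ₜ[ℂ] (h.vacuumAct hhw ⁅x, y⁆ v)
      = 1 ⊗ₜ (h.vacuumAct hhw x (h.vacuumAct hhw y v) - h.vacuumAct hhw y (h.vacuumAct hhw x v)) := by
    rw [TensorProduct.tmul_sub]
    rw [← sub_eq_iff_eq_add'] at h2
    rw [← h2]
    abel
  have h4 := congrArg h.tensorMap h3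
  rw [tensorMap_tmul, tensorMap_tmul, fockMap_one, fockMap_one, Subtype.coe_inj] at h4
  rw [h4, Ring.lie_def, LinearMap.sub_apply, Module.End.mul_apply, Module.End.mul_apply]

/-! ### Simplicity and weights of the even vacuum module -/

theorem nontrivial_evenVacuum (h : A.HasLevel r) (hhw : A.IsHighestWeight) [Nontrivial V] :
    Nontrivial A.evenVacuum := by
  by_contra hcon
  rw [not_nontrivial_iff_subsingleton] at hcon
  obtain ⟨v, hv⟩ := exists_ne (0 : V)
  apply hv
  rw [← h.tensorMap_symm_apply hhw v]
  induction (h.tensorEquiv hhw).symm v using TensorProduct.induction_on with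
  | zero => exact map_zero _
  | add t t' ht ht' => rw [map_add, ht, ht', add_zero]
  | tmul x w => rw [Subsingleton.elim w 0, TensorProduct.tmul_zero, map_zero]

/-- A stable N generates the graded submodule U corresponding to 𝒱 ⊗ N. Simplicity of V decides U,
and N is recovered from U. -/
theorem eq_bot_or_eq_top_of_vacuumAct (h : A.HasLevel r) (hhw : A.IsHighestWeight)
    (hs : A.IsSimple) {N : Submodule ℂ A.evenVacuum}
    (hN : ∀ x, ∀ v ∈ N, h.vacuumAct hhw x v ∈ N) : N = ⊥ ∨ N = ⊤ := by
  set U : Submodule ℂ V := Submodule.map₂ h.fockMap ⊤ (N.map A.evenVacuum.subtype) with hU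
  have hmem : ∀ x, ∀ n ∈ N, h.fockMap x n ∈ U := fun x n hn =>
    Submodule.apply_mem_map₂ _ Submodule.mem_top (Submodule.mem_map_of_mem hn)
  have hle : ∀ {W : Submodule ℂ V}, (∀ x, ∀ n ∈ N, h.fockMap x n ∈ W) → U ≤ W := by
    intro W hW
    refine Submodule.map₂_le.2 fun x _ w hw => ?_
    obtain ⟨n, hn, rfl⟩ := hw
    exact hW x n hn
  have hgr : A.grading.IsGraded U := A.grading.isGraded_of_parityOp_mem fun v hv => by
    have : U ≤ U.comap A.grading.parityOp := hle fun x n hn => by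
      rw [Submodule.mem_comap, h.parityOp_fockMap x n.2]
      exact hmem _ n hn
    exact this hv
  have hvir : ∀ (x : Vir), ∀ v ∈ U, A.act (virIncl x) v ∈ U := by
    intro x v hv
    have : U ≤ U.comap (A.act (virIncl x)) := hle fun y n hn => by
      have := h.act_tensorMap hhw x (y ⊗ₜ n)
      rw [map_add, LinearMap.rTensor_tmul, LinearMap.lTensor_tmul, tensorMap_tmul, tensorMap_tmul,
        tensorMap_tmul] at this
      rw [Submodule.mem_comap, this]
      exact U.add_mem (hmem _ n hn) (hmem _ _ (hN x n hn))
    exact this hv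
  have hst : ∀ x : S, ∀ v ∈ U, A.act x v ∈ U := by
    intro x v hv
    refine S.mem_of_basis (f := A.act.flip v) (fun b => ?_) x
    change A.act (S.e b) v ∈ U
    cases b with
    | L n => simpa [virIncl_e, VirIdx.toSIdx] using hvir (Vir.e (.L n)) v hv
    | c => simpa [virIncl_e, VirIdx.toSIdx] using hvir (Vir.e .c) v hv
    | z => rw [h.act_z]; exact U.smul_mem _ hv
    | psi n =>
      have : U ≤ U.comap (A.act (S.e (.psi n))) := hle fun y m hm => by
        rw [Submodule.mem_comap, ← h.fockMap_psi n y m.2]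
        exact U.smul_mem _ (hmem _ m hm)
      exact this hv
  rcases hs.2 U hgr hst with hbot | htop
  · left
    rw [eq_bot_iff]
    intro n hn
    have h1 := hmem 1 n hn
    rw [hbot, fockMap_one, Submodule.mem_bot, Submodule.coe_eq_zero] at h1
    exact h1
  · right
    rw [eq_top_iff]
    intro m _
    -- π takes the constant term in the Fock factor. It maps U into N and fixes the even vacuum
    -- vectors, so U = V forces N to be everything.
    let π : V →ₗ[ℂ] A.evenVacuum := TensorProduct.lid ℂ A.evenVacuum ∘ₗ
      (ExteriorAlgebra.algebraMapInv (R := ℂ) (M := ℕ →₀ ℂ)).toLinearMap.rTensor A.evenVacuum ∘ₗ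
        (h.tensorEquiv hhw).symm.toLinearMap
    have hπ : ∀ x (n : A.evenVacuum), π (h.fockMap x n)
        = ExteriorAlgebra.algebraMapInv (R := ℂ) x • n := fun x n => by
      rw [← tensorMap_tmul]
      simp [π, symm_tensorMap]
    have hUN : U ≤ N.comap π := hle fun x n hn => by
      rw [Submodule.mem_comap, hπ]
      exact N.smul_mem _ hn
    have hm : (m : V) ∈ U := htop ▸ Submodule.mem_top
    have h1 := hUN hm
    rwa [← h.fockMap_one (m : V), Submodule.mem_comap, hπ, map_one, one_smul] at h1

/-- The Fock vacuum has L̄₀-eigenvalue 1/16, so on even vacuum vectors the new L₀ is the old one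
minus 1/16. -/
theorem isHighestWeightOp_vacuumAct (h : A.HasLevel r) (hhw : A.IsHighestWeight) :
    IsHighestWeightOp (h.vacuumAct hhw (Vir.e (.L 0))) := by
  refine IsHighestWeightOp.of_restrict (T := A.act (S.e (.L 0))) (s := 1 / 16) hhw fun v => ?_
  have h1 := h.virShift_tensorMap hhw (Vir.e (.L 0)) (1 ⊗ₜ v)
  rw [virIncl_e, VirIdx.toSIdx, LinearMap.rTensor_tmul, fock_act_L, fockL_zero_one, tensorMap_tmul,
    tensorMap_tmul, map_smul, LinearMap.smul_apply, fockMap_one] at h1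
  rw [coe_vacuumAct, h1]

theorem tensorEquiv_mem_part (h : A.HasLevel r) (hhw : A.IsHighestWeight) (i : ZMod 2)
    {t : Fock ⊗[ℂ] A.evenVacuum}
    (ht : t ∈ (fockAction.grading.tensor (SuperGrading.pureEven A.evenVacuum)).part i) :
    h.tensorEquiv hhw t ∈ A.grading.part i := by
  have hle : (fockAction.grading.tensor (SuperGrading.pureEven A.evenVacuum)).part i
      ≤ (A.grading.part i).comap h.tensorMap := by
    refine iSup_le fun j => Submodule.map₂_le.2 fun x hx v hv => ?_
    change h.fockMap x v ∈ A.grading.part i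
    by_cases hij : i - j = 0
    · obtain rfl := sub_eq_zero.1 hij
      exact SuperGrading.map_mem_of_parityOp fockAction.grading A.grading (T := h.fockMap.flip v)
        (fun x => h.parityOp_fockMap x v.2) i hx
    · have hv0 : v = 0 := by
        change v ∈ (if i - j = 0 then ⊤ else ⊥ : Submodule ℂ A.evenVacuum) at hv
        rwa [if_neg hij, Submodule.mem_bot] at hv
      rw [hv0, Submodule.coe_zero, map_zero]
      exact Submodule.zero_mem _
  exact hle ht

end HasLevel

end SuperAction

/-- The action on the tensor product with an inflated module. -/
theorem tensor_inflate_act {V M : Type*} [AddCommGroup V] [Module ℂ V] [AddCommGroup M]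
    [Module ℂ M] [LieRingModule Vir M] [LieModule ℂ Vir M] (B : SuperAction S V) (a : SIdx)
    (t : V ⊗[ℂ] M) : (B.tensor (inflate M)).act (S.e a) t
      = (B.act (S.e a)).rTensor M t + (virAct M (virProj (S.e a))).lTensor V t := by
  have hψ : ∀ n, virProj (S.e (.psi n)) = 0 := fun n => by simp [virProj, S.e]
  change (B.act (S.e a)).rTensor M t
    + (virAct M (virProj (S.grading.evenProj (S.e a)))).lTensor V t
    + TensorProduct.map B.grading.parityOp
      (virAct M (virProj (S.grading.oddProj (S.e a)))) t = _
  by_cases ha : ∃ n, a = .psi n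
  · obtain ⟨n, rfl⟩ := ha
    rw [S.grading.evenProj_of_odd (S.e_mem (.psi n)), S.grading.oddProj_of_odd (S.e_mem (.psi n)),
      hψ, map_zero, map_zero, TensorProduct.map_zero_right, LinearMap.zero_apply, add_zero]
  · have h0 : S.e a ∈ S.grading.part 0 := by
      cases a with
      | psi n => exact absurd ⟨n, rfl⟩ ha
      | L n => exact S.e_mem (.L n)
      | c => exact S.e_mem .c
      | z => exact S.e_mem .z
    rw [S.grading.evenProj_of_even h0, S.grading.oddProj_of_even h0, map_zero, map_zero,
      TensorProduct.map_zero_right, LinearMap.zero_apply, add_zero]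

theorem exists_iso_tensor {V : Type u} [AddCommGroup V] [Module ℂ V] {A : SuperAction S V} {r : ℂ}
    (h : A.HasLevel r) (hsimple : A.IsSimple) (hhw : A.IsHighestWeight) :
    ∃ (M : Type u) (_ : AddCommGroup M) (_ : Module ℂ M) (_ : LieRingModule Vir M)
      (_ : LieModule ℂ Vir M),
      LieModule.IsIrreducible ℂ Vir M ∧ VirIsHighestWeight M ∧
        A.IsIso ((fockAction.twist (sigma r)).tensor (inflate M)) := by
  obtain ⟨i1, i2, hact⟩ := exists_lieModule_of_lie (h.vacuumAct hhw) (h.vacuumAct_lie hhw)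
  have hvir : virAct A.evenVacuum = h.vacuumAct hhw :=
    LinearMap.ext fun x => LinearMap.ext fun v => hact x v
  have := hsimple.1
  have := h.nontrivial_evenVacuum hhw
  refine ⟨A.evenVacuum, inferInstance, inferInstance, i1, i2,
    isIrreducible_of_submodule fun N hN => ?_, ?_, (h.tensorEquiv hhw).symm, fun i v hv => ?_,
    fun x v => ?_⟩
  · exact h.eq_bot_or_eq_top_of_vacuumAct hhw hsimple fun x v hv => hact x v ▸ hN x v hv
  · rw [VirIsHighestWeight, hvir]
    exact h.isHighestWeightOp_vacuumAct hhw
  · exact SuperGrading.symm_mem_part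
      (fockAction.grading.tensor (SuperGrading.pureEven A.evenVacuum)) A.grading
      (h.tensorEquiv hhw) (fun i t ht => h.tensorEquiv_mem_part hhw i ht) i hv
  · obtain ⟨t, rfl⟩ := h.tensorMap_surjective hhw v
    rw [LinearEquiv.symm_apply_eq, h.symm_tensorMap, h.tensorEquiv_apply]
    have hlin : A.act.flip (h.tensorMap t) = h.tensorMap ∘ₗ
        ((fockAction.twist (sigma r)).tensor (inflate A.evenVacuum)).act.flip t := by
      refine Finsupp.lhom_ext' fun a => LinearMap.ext_ring ?_
      change A.act (S.e a) (h.tensorMap t) = h.tensorMap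
        (((fockAction.twist (sigma r)).tensor (inflate A.evenVacuum)).act (S.e a) t)
      rw [tensor_inflate_act, hvir]
      cases a with
      | L n =>
        have := h.act_tensorMap hhw (Vir.e (.L n)) t
        rw [virIncl_e, VirIdx.toSIdx] at this
        rw [this, show virProj (S.e (.L n)) = Vir.e (.L n) by simp [virProj, S.e]]
      | c =>
        have := h.act_tensorMap hhw (Vir.e .c) t
        rw [virIncl_e, VirIdx.toSIdx] at this
        rw [this, show virProj (S.e .c) = Vir.e .c by simp [virProj, S.e]]
      | psi n =>
        rw [show virProj (S.e (.psi n)) = 0 by simp [virProj, S.e], map_zero,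
          LinearMap.lTensor_zero, LinearMap.zero_apply, add_zero,
          h.act_fermion (Submodule.subset_span (Or.inl ⟨n, rfl⟩))]
      | z =>
        rw [show virProj (S.e .z) = 0 by simp [virProj, S.e], map_zero,
          LinearMap.lTensor_zero, LinearMap.zero_apply, add_zero,
          h.act_fermion (Submodule.subset_span (Or.inr rfl))]
    exact LinearMap.congr_fun hlin x

end FermionVirasoro

end

open FermionVirasoro in
theorem theorem4p6 {V : Type u} [AddCommGroup V] [Module ℂ V] (A : SuperAction S V)
    (hmod : A.IsModule) (hsimple : A.IsSimple) (hhw : A.IsHighestWeight) :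
    (∀ l : ℂ, l ≠ 0 → (∀ v : V, A.act (S.e .z) v = l • v) →
      ∃ r : ℂ, r ^ 2 = l ∧ (fockAction.twist (sigma r)).IsModule ∧
        ∃ (M : Type u) (_ : AddCommGroup M) (_ : Module ℂ M) (_ : LieRingModule Vir M)
          (_ : LieModule ℂ Vir M),
          LieModule.IsIrreducible ℂ Vir M ∧ VirIsHighestWeight M ∧
            A.IsIso ((fockAction.twist (sigma r)).tensor (inflate M))) ∧
    ((∀ v : V, A.act (S.e .z) v = 0) →
      (∀ x ∈ fermion, ∀ v : V, A.act x v = 0) ∧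
        ∃ (_ : LieRingModule Vir V) (_ : LieModule ℂ Vir V),
          (∀ (x : Vir) (v : V), ⁅x, v⁆ = A.act (virIncl x) v) ∧
            LieModule.IsIrreducible ℂ Vir V ∧ VirIsHighestWeight V) := by
  refine ⟨fun l hl hz => ?_, fun hz => ?_⟩
  -- Either square root serves, as the construction uses only r² = l and r ≠ 0.
  · obtain ⟨r, rfl⟩ := IsAlgClosed.exists_pow_nat_eq l (n := 2) two_pos
    have hr : r ≠ 0 := fun h => hl (by rw [h, zero_pow two_ne_zero])
    exact ⟨r, rfl, fock_isModule r, exists_iso_tensor ⟨hmod, hr, hz⟩ hsimple hhw⟩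
  · have hF := SuperAction.fermion_eq_zero hmod hsimple hhw hz
    exact ⟨hF, exists_vir_of_z_eq_zero hmod hsimple hhw hF⟩
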